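/- \textbf{Notation.} Let $R$ be a commutative ring in which $2$ is invertible. Groups also denote the corresponding constant group schemes. Let $U_4$ be the group of upper triangular unipotent $4\times 4$ matrices over $\mathbb{Z}/2$, with entries $a_{ij}$, let $E_{ij}\in U_4$ ($i<j$) be the matrix whose only non-zero off-diagonal entry is $a_{ij}=1$, and let $q=a_{12}\times a_{23}\times a_{34}:U_4\to(\mathbb{Z}/2)^3$. Products of schemes are over $\operatorname{Spec}R$ unless indicated otherwise, and $L_z=\operatorname{Spec}R[z,z^{-1}]$. Let $\mathcal{L}=L_\alpha\times L_\beta\times L_\gamma$. The group $(\mathbb{Z}/2)^3$ acts on $\mathcal{L}$ by signs on $\alpha,\beta,\gamma$, and $U_4$ acts through $q$, so that $g^*\alpha=(-1)^{a_{12}(g)}\alpha$, $g^*\beta=(-1)^{a_{23}(g)}\beta$, $g^*\gamma=(-1)^{a_{34}(g)}\gamma$. Let $\mathcal{L}\to L_a\times L_b\times L_c$ be the (Kummer) map given by $a\mapsto\alpha^2$, $b\mapsto\beta^2$, $c\mapsto\gamma^2$. Let $\tilde H\subset U_4$ be the subgroup $a_{12}=a_{13}=0$, let $\sigma_{14}$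 be the rank one representation of $\tilde H$ on $R$ in which $h$ acts by $(-1)^{a_{14}(h)}$, and let $V=\operatorname{Ind}_{\tilde H}^{U_4}\sigma_{14}=R[U_4]\otimes_{R[\tilde H]}\sigma_{14}$. Writing $g\tilde H$ for $g\otimes 1$, $V$ has the basis $$u_1=\tilde H+E_{13}\tilde H,\quad u_2=\tilde H-E_{13}\tilde H,\quad u_3=E_{12}\tilde H+E_{12}E_{13}\tilde H,\quad u_4=E_{12}\tilde H-E_{12}E_{13}\tilde H,$$ with dual basis $u_1^*,\dots,u_4^*$. Let $\mathcal{V}=\operatorname{Spec}\operatorname{Sym}V^*=\operatorname{Spec}R[u_1^*,u_2^*,u_3^*,u_4^*]$ and let $\mathbb{G}_{m,R}^4\subset\mathcal{V}$ be the complement of the zero locus of $u_1^*u_2^*u_3^*u_4^*$; it is stable under the action of $U_4$ on $\mathcal V$ through $V$. Let $U_4$ act diagonally on $\mathbb{G}_{m,R}^4\times\mathcal{L}$. Let $S=L_a\times L_c$ and $S'=L_\alpha\times L_\gamma$, with $S'\to S$ given by $a\mapsto\alpha^2$, $c\mapsto\gamma^2$. The restriction of scalars $\operatorname{Res}_{S'/S}\mathbb{G}_{m,S'}$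 is the open subscheme of $\mathbb{A}^4_S$, with coordinates $y=y_1+y_\alpha\alpha+y_\gamma\gamma+y_{\alpha\gamma}\alpha\gamma$, on which the norm $$N_{S'/S}(y)=\prod_{i,j=0,1}\bigl(y_1+(-1)^iy_\alpha\alpha+(-1)^jy_\gamma\gamma+(-1)^{i+j}y_{\alpha\gamma}\alpha\gamma\bigr)=(y_1^2-ay_\alpha^2+cy_\gamma^2-ac\,y_{\alpha\gamma}^2)^2-c(2y_1y_\gamma-2a\,y_\alpha y_{\alpha\gamma})^2$$ is invertible. Let $\mathcal{X}$ be the closed subscheme $$b\,x^2=N_{S'/S}(y)\quad\text{of}\quad \operatorname{Res}_{S'/S}\mathbb{G}_{m,S'}\times\operatorname{Spec}R[b,b^{-1},x,x^{-1}],$$ and let $\pi:\mathcal{X}\to L_a\times L_b\times L_c$ be its structure map. Put $$d_1=u_1^{*2}+u_2^{*2}+u_3^{*2}+u_4^{*2},\qquad d_2=u_1^{*2}+u_2^{*2}-u_3^{*2}-u_4^{*2},$$ $$d_3=u_1^{*2}-u_2^{*2}+u_3^{*2}-u_4^{*2},\qquad d_4=u_1^{*2}-u_2^{*2}-u_3^{*2}+u_4^{*2},$$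 and let $f:\mathbb{G}_{m,R}^4\times\mathcal{L}\to\mathcal{X}$ be the map given by $$x\mapsto 2^4u_1^*u_2^*u_3^*u_4^*/\beta,\quad y_1\mapsto d_1,\quad y_\alpha\mapsto d_2/\alpha,\quad y_\gamma\mapsto d_3/\gamma,\quad y_{\alpha\gamma}\mapsto d_4/(\alpha\gamma),\quad a\mapsto\alpha^2,\ b\mapsto\beta^2,\ c\mapsto\gamma^2.$$ For a finite group $G$, a scheme $P$ with an action of $G$ and a $G$-invariant map $P\to X$, we call $P\to X$ a $G$-torsor if it is étale and surjective and $G\times P\to P\times_XP$, $(g,p)\mapsto(gp,p)$, is an isomorphism. The push-forward of $P=\mathbb{G}_{m,R}^4\times\mathcal{L}$ along $q$ is $q_*P=P\times^{U_4}(\mathbb{Z}/2)^3:=(P\times(\mathbb{Z}/2)^3)/U_4$, with its map to $\mathcal X$ induced by $f$ and its action of $(\mathbb{Z}/2)^3$. \textbf{Theorem.} With this notation: \begin{enumerate} \item the map $f:\mathbb{G}_{m,R}^4\times\mathcal{L}\to\mathcal{X}$ is a $U_4$-torsor; \item $\mathcal{L}\to L_a\times L_b\times L_c$ is a $(\mathbb{Z}/2)^3$-torsor,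 and $q_*(\mathbb{G}_{m,R}^4\times\mathcal{L})$ and $\pi^*\mathcal{L}=\mathcal{X}\times_{L_a\times L_b\times L_c}\mathcal{L}$ are $(\mathbb{Z}/2)^3$-torsors over $\mathcal{X}$; \item there is an isomorphism $q_*(\mathbb{G}_{m,R}^4\times\mathcal{L})\cong\pi^*\mathcal{L}$ of $(\mathbb{Z}/2)^3$-torsors over $\mathcal{X}$, that is, an isomorphism of schemes over $\mathcal X$ that is equivariant for $(\mathbb{Z}/2)^3$. \end{enumerate} -/

import Mathlib

open CategoryTheory CategoryTheory.Limits AlgebraicGeometry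
open scoped TensorProduct

universe u

namespace MasseyTorsor

/-! ### Actions of abstract groups on schemes, torsors, contracted products -/

/-- A left action of an abstract group `G` (that is, of the constant group scheme `G`) on a
scheme `P`. Composition `≫` is in diagrammatic order: `f ≫ g` is first `f`, then `g`. -/
structure SchemeAction (G : Type) [Group G] (P : Scheme.{u}) where
  act : G → (P ⟶ P)
  act_one : act 1 = 𝟙 P
  act_mul : ∀ g h, act (g * h) = act h ≫ act g

/-- `f : P ⟶ X` with the action `ρ` of `G` on `P` is a `G`-torsor over `X` (for the étale
topology): `f` is `G`-invariant, étale and surjective, and `(g, p) ↦ (g p, p)` is an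
isomorphism from `G × P = ∐_{g ∈ G} P` to `P ×_X P`. -/
structure IsTorsor {G : Type} [Group G] {P X : Scheme.{u}} (f : P ⟶ X) (ρ : SchemeAction G P) :
    Prop where
  invariant : ∀ g, ρ.act g ≫ f = f
  etale : Etale f
  surjective : Surjective f
  isIso_shear : IsIso (Sigma.desc fun g : G =>
    pullback.lift (f := f) (g := f) (ρ.act g) (𝟙 P) (by simp [invariant g]))

/-- `P ⟶ X` and `Q ⟶ X`, with actions of `G` on `P` and `Q`, are isomorphic as `G`-torsors
over `X`: there is a `G`-equivariant isomorphism `P ≅ Q` over `X`. -/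
def TorsorIso {G : Type} [Group G] {P Q X : Scheme.{u}} (f : P ⟶ X) (ρ : SchemeAction G P)
    (f' : Q ⟶ X) (ρ' : SchemeAction G Q) : Prop :=
  ∃ e : P ≅ Q, e.hom ≫ f' = f ∧ ∀ g, ρ.act g ≫ e.hom = e.hom ≫ ρ'.act g

/-- The action on `Spec B` given by an action `ρ` of `G` on functions by
`(g • b)(p) = b (g⁻¹ p)`; so the comorphism `g^*` of `g` is `ρ g⁻¹`. -/
noncomputable def specAction {R : Type u} [CommRing R] {B : Type u} [CommRing B] [Algebra R B]
    {G : Type} [Group G] (ρ : G →* (B →ₐ[R] B)) : SchemeAction G (Spec (CommRingCat.of B)) where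
  act g := Spec.map (CommRingCat.ofHom (ρ g⁻¹).toRingHom)
  act_one := by rw [inv_one, map_one]; exact Spec.map_id _
  act_mul g h := by
    rw [← Spec.map_comp, ← CommRingCat.ofHom_comp, mul_inv_rev, map_mul]; rfl

/-- The morphism `Spec B ⟶ Spec A` given by an algebra homomorphism `A → B`. -/
noncomputable def specMap {R : Type u} [CommRing R] {A B : Type u} [CommRing A] [CommRing B]
    [Algebra R A] [Algebra R B] (f : A →ₐ[R] B) :
    Spec (CommRingCat.of B) ⟶ Spec (CommRingCat.of A) :=
  Spec.map (CommRingCat.ofHom f.toRingHom)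

lemma specAction_invariant {R : Type u} [CommRing R] {A B : Type u} [CommRing A] [CommRing B]
    [Algebra R A] [Algebra R B] {G : Type} [Group G] (ρ : G →* (B →ₐ[R] B)) (f : A →ₐ[R] B)
    (hf : ∀ g a, ρ g (f a) = f a) (g : G) : (specAction ρ).act g ≫ specMap f = specMap f := by
  rw [specAction, specMap, ← Spec.map_comp, ← CommRingCat.ofHom_comp]
  congr 2
  ext a
  exact hf _ a

/-- The action on a pullback `X ×_Y L` through the second factor. -/
noncomputable def pullbackAction {G : Type} [Group G] {X Y L : Scheme.{u}} (p : X ⟶ Y)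
    (k : L ⟶ Y) (ρ : SchemeAction G L) (hk : ∀ g, ρ.act g ≫ k = k) :
    SchemeAction G (pullback p k) where
  act g := pullback.lift (pullback.fst p k) (pullback.snd p k ≫ ρ.act g)
      (by rw [Category.assoc, hk, pullback.condition])
  act_one := by apply pullback.hom_ext <;> simp [ρ.act_one]
  act_mul g h := by
    apply pullback.hom_ext
    · rw [pullback.lift_fst]
      exact ((Category.assoc _ _ _).trans (by rw [pullback.lift_fst, pullback.lift_fst])).symm
    · rw [pullback.lift_snd, ρ.act_mul]
      exact ((Category.assoc _ _ _).trans (by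
        rw [pullback.lift_snd, pullback.lift_snd_assoc, Category.assoc])).symm

section
variable {R : Type u} [CommRing R] {B : Type u} [CommRing B] [Algebra R B]
  {G H : Type} [Group G] [Group H]

/-- The ring of invariants `B^G`. The quotient of `Spec B` by the finite group `G` is
`Spec (B^G)`. -/
def invariants (ρ : G →* (B →ₐ[R] B)) : Subalgebra R B where
  carrier := {b | ∀ g, ρ g b = b}
  mul_mem' ha hb g := by rw [map_mul, ha g, hb g]
  add_mem' ha hb g := by rw [map_add, ha g, hb g]
  algebraMap_mem' r g := by simp

/-- Let `G` act on `P = Spec B`, and on `H` through `q`. The functions on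
`H × P = ∐_{h ∈ H} P` are the families `H → B`, and this is the action of `G` on them
that belongs to the action `g (h, p) = (h q(g)⁻¹, g p)` on `H × P`. -/
def diagAction (q : G →* H) (ρ : G →* (B →ₐ[R] B)) : G →* ((H → B) →ₐ[R] (H → B)) where
  toFun g := AlgHom.pi fun h => (ρ g).comp (Pi.evalAlgHom R (fun _ : H => B) (h * q g))
  map_one' := by ext φ h; simp
  map_mul' g g' := by ext φ h; simp [mul_assoc]

/-- The ring of functions of the contracted product `q_* P = (H × P) / G`, `P = Spec B`. -/
abbrev pushRing (q : G →* H) (ρ : G →* (B →ₐ[R] B)) : Subalgebra R (H → B) :=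
  invariants (diagAction q ρ)

/-- The action of `H` on the functions of `q_* P` that belongs to `k [h, p] = [k h, p]`. -/
def pushAction (q : G →* H) (ρ : G →* (B →ₐ[R] B)) :
    H →* (pushRing q ρ →ₐ[R] pushRing q ρ) where
  toFun k := AlgHom.codRestrict
    ((AlgHom.pi fun h => Pi.evalAlgHom R (fun _ : H => B) (k⁻¹ * h)).comp
    (pushRing q ρ).val) (pushRing q ρ) (fun φ g => by
      ext h
      have := congrFun (φ.2 g) (k⁻¹ * h)
      simpa [diagAction, mul_assoc] using this)
  map_one' := by ext φ h; simp
  map_mul' g g' := by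
    ext φ h
    change φ.1 ((g * g')⁻¹ * h) = φ.1 (g'⁻¹ * (g⁻¹ * h))
    rw [mul_inv_rev, mul_assoc]

/-- For a `G`-invariant morphism `P = Spec B ⟶ Spec A` given by `f`, the comorphism of the
induced morphism `q_* P ⟶ Spec A`, `[h, p] ↦ f(p)`. -/
def pushStr (q : G →* H) (ρ : G →* (B →ₐ[R] B)) {A : Type u} [CommRing A] [Algebra R A]
    (f : A →ₐ[R] B) (hf : ∀ g a, ρ g (f a) = f a) : A →ₐ[R] pushRing q ρ :=
  AlgHom.codRestrict (AlgHom.pi fun _ : H => f) (pushRing q ρ) (fun a g => by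
    ext h
    simpa [diagAction] using hf g a)

end

/-! ### The group `U₄` and the induced representation `V` -/

/-- The group `U₄` of upper triangular unipotent `4 × 4` matrices over `ℤ/2`. -/
def U4 : Subgroup (Matrix (Fin 4) (Fin 4) (ZMod 2))ˣ where
  carrier := {g | (∀ i, g.1 i i = 1) ∧ ∀ i j, j < i → g.1 i j = 0}
  mul_mem' := by
    rintro g h ⟨hg, hg'⟩ ⟨hh, hh'⟩
    refine ⟨fun i => ?_, fun i j hij => ?_⟩
    · rw [Units.val_mul, Matrix.mul_apply, Finset.sum_eq_single i]
      · rw [hg, hh, one_mul]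
      · intro k _ hk
        rcases lt_or_gt_of_ne hk with h | h
        · rw [hg' i k h, zero_mul]
        · rw [hh' k i h, mul_zero]
      · simp
    · rw [Units.val_mul, Matrix.mul_apply]
      refine Finset.sum_eq_zero fun k _ => ?_
      rcases lt_or_ge k i with h | h
      · rw [hg' i k h, zero_mul]
      · rw [hh' k j (hij.trans_le h), mul_zero]
  one_mem' := ⟨fun i => by simp, fun i j h => by simp [Matrix.one_apply_ne h.ne']⟩
  inv_mem' := by
    rintro g ⟨hg, hg'⟩
    have hT : Matrix.BlockTriangular g.1 id := fun i j h => hg' i j h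
    have : Invertible g.1 := g.invertible
    have hi : Matrix.BlockTriangular (g⁻¹).1 id := by
      have := Matrix.blockTriangular_inv_of_blockTriangular hT
      rwa [← Matrix.coe_units_inv] at this
    refine ⟨fun i => ?_, fun i j h => hi h⟩
    have h1 : (g.1 * (g⁻¹).1) i i = 1 := by simp
    rw [Matrix.mul_apply, Finset.sum_eq_single i] at h1
    · rwa [hg, one_mul] at h1
    · intro k _ hk
      rcases lt_or_gt_of_ne hk with h | h
      · rw [hg' i k h, zero_mul]
      · rw [hi h, mul_zero]
    · simp

/-- The matrix entry of `g`. Indices start at `0`: the function usually written `a_{ij}`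
(`1 ≤ i, j ≤ 4`) is `entry (i - 1) (j - 1)`; so `a₁₂, a₂₃, a₃₄, a₁₃, a₂₄, a₁₄` are
`entry 0 1`, `entry 1 2`, `entry 2 3`, `entry 0 2`, `entry 1 3`, `entry 0 3`. -/
def entry (i j : Fin 4) (g : U4) : ZMod 2 := g.1.1 i j

lemma a_mul (i j : Fin 4) (g h : U4) : entry i j (g * h) = ∑ k, entry i k g * entry k j h := by
  exact Matrix.mul_apply

lemma a_diag (i : Fin 4) (g : U4) : entry i i g = 1 := g.2.1 i
lemma a_low (i j : Fin 4) (h : j < i) (g : U4) : entry i j g = 0 := g.2.2 i j h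

lemma a01_mul (g h : U4) : entry 0 1 (g * h) = entry 0 1 g + entry 0 1 h := by
  simp [a_mul, Fin.sum_univ_four, a_diag, a_low, add_comm]
lemma a12_mul (g h : U4) : entry 1 2 (g * h) = entry 1 2 g + entry 1 2 h := by
  simp [a_mul, Fin.sum_univ_four, a_diag, a_low, add_comm]
lemma a23_mul (g h : U4) : entry 2 3 (g * h) = entry 2 3 g + entry 2 3 h := by
  simp [a_mul, Fin.sum_univ_four, a_diag, a_low, add_comm]
lemma a02_mul (g h : U4) : entry 0 2 (g * h) = entry 0 2 h + entry 0 1 g * entry 1 2 h + entry 0 2 g := by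
  simp [a_mul, Fin.sum_univ_four, a_diag, a_low]
lemma a13_mul (g h : U4) : entry 1 3 (g * h) = entry 1 3 h + entry 1 2 g * entry 2 3 h + entry 1 3 g := by
  simp [a_mul, Fin.sum_univ_four, a_diag, a_low]
lemma a03_mul (g h : U4) : entry 0 3 (g * h) =
    entry 0 3 h + entry 0 1 g * entry 1 3 h + entry 0 2 g * entry 2 3 h + entry 0 3 g := by
  simp [a_mul, Fin.sum_univ_four, a_diag, a_low]

/-- The elementary matrix with `1` on the diagonal and at the place `(i, j)`, `0` elsewhere
(indices start at `0`, so `E 0 1`, `E 0 2` are usually written `E₁₂`, `E₁₃`). -/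
def E (i j : Fin 4) (h : i < j) : U4 :=
  ⟨⟨Matrix.transvection i j 1, Matrix.transvection i j 1,
    by rw [Matrix.transvection_mul_transvection_same _ _ h.ne, one_add_one_eq_two,
        show (2 : ZMod 2) = 0 from rfl, Matrix.transvection_zero],
    by rw [Matrix.transvection_mul_transvection_same _ _ h.ne, one_add_one_eq_two,
        show (2 : ZMod 2) = 0 from rfl, Matrix.transvection_zero]⟩,
   by
    refine ⟨fun k => ?_, fun k l hkl => ?_⟩
    · have : ¬ (i = k ∧ j = k) := fun hh => h.ne (hh.1.trans hh.2.symm)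
      simp [Matrix.transvection, Matrix.single_apply, this]
    · have : ¬ (i = k ∧ j = l) := fun hh => (h.trans (hh.2 ▸ hkl)).ne hh.1
      simp [Matrix.transvection, Matrix.single_apply, this, Matrix.one_apply_ne hkl.ne']⟩

/-- The subgroup `H̃` of `U₄` given by `a₁₂ = a₁₃ = 0`. -/
def Htilde : Subgroup U4 where
  carrier := {g | entry 0 1 g = 0 ∧ entry 0 2 g = 0}
  mul_mem' := by
    rintro g h ⟨h1, h2⟩ ⟨h3, h4⟩
    exact ⟨by rw [a01_mul, h1, h3, add_zero], by rw [a02_mul, h1, h2, h4]; simp⟩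
  one_mem' := ⟨rfl, rfl⟩
  inv_mem' := by
    rintro g ⟨h1, h2⟩
    have e1 := a01_mul g g⁻¹
    have e2 := a02_mul g g⁻¹
    rw [mul_inv_cancel, h1, zero_add] at e1
    rw [mul_inv_cancel, h1, h2, zero_mul, add_zero, add_zero] at e2
    exact ⟨e1.symm, e2.symm⟩

/-- The sign `(-1)^x` for `x ∈ ℤ/2`. -/
def sgn (R : Type u) [CommRing R] (x : ZMod 2) : R := (-1) ^ x.val

lemma sgn_zero (R : Type u) [CommRing R] : sgn R 0 = 1 := by simp [sgn]

lemma sgn_add (R : Type u) [CommRing R] (x y : ZMod 2) : sgn R (x + y) = sgn R x * sgn R y := by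
  rw [sgn, ZMod.val_add, ← neg_one_pow_eq_pow_mod_two, pow_add, sgn, sgn]

lemma sgn_mul_self (R : Type u) [CommRing R] (x : ZMod 2) : sgn R x * sgn R x = 1 := by
  rw [← sgn_add, CharTwo.add_self_eq_zero, sgn_zero]

section
variable (R : Type u) [CommRing R]

/-- The rank one representation `σ₁₄` of `H̃`: `h` acts on `R` by `(-1)^{a₁₄(h)}`. -/
noncomputable def sigma14 : Representation R Htilde R where
  toFun h := sgn R (entry 0 3 h) • LinearMap.id
  map_one' := by
    have : entry 0 3 (1 : U4) = 0 := rfl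
    rw [OneMemClass.coe_one, this, sgn_zero, one_smul]; rfl
  map_mul' g h := by
    have : entry 0 3 ((g * h : Htilde) : U4) = entry 0 3 g + entry 0 3 h := by
      rw [Subgroup.coe_mul, a03_mul, g.2.1, g.2.2]; ring
    rw [this, sgn_add]
    ext
    simp [mul_comm]

/-- The module `V = Ind_{H̃}^{U₄} σ₁₄`. -/
abbrev V := Representation.IndV Htilde.subtype (sigma14 R)

/-- The induced representation of `U₄` on `V`. -/
noncomputable def ρV : Representation R U4 (V R) := Representation.ind Htilde.subtype (sigma14 R)

/-- The element `g ⊗ 1` of `V = R[U₄] ⊗_{R[H̃]} σ₁₄`, the basis vector of the coset `g H̃`.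
(Mathlib writes the induced module as coinvariants and `g ⊗ a` as `⟦g⁻¹ ⊗ a⟧`; the next two lemmas
spell out the convention.) -/
noncomputable def coset (g : U4) : V R := Representation.IndV.mk Htilde.subtype (sigma14 R) g⁻¹ 1

lemma rhoV_coset (g g' : U4) : ρV R g (coset R g') = coset R (g * g') := by
  rw [ρV, coset, coset, Representation.ind_mk, mul_inv_rev]

lemma coset_mul (g : U4) (h : Htilde) : coset R (g * h) = sgn R (entry 0 3 h) • coset R g := by
  have h1 := Representation.Coinvariants.mk_self_apply
    (Representation.tprod ((Representation.leftRegular R U4).comp Htilde.subtype) (sigma14 R)) h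
    (MonoidAlgebra.single (g * h)⁻¹ (1 : R) ⊗ₜ[R] (1 : R))
  have h2 : coset R (g * h) = Representation.Coinvariants.mk _ _ := h1.symm
  rw [h2, coset, ← map_smul]
  simp [sigma14]
  rfl

/-- The vectors `u₁, u₂, u₃, u₄` of `V`, indexed by `(0,0), (0,1), (1,0), (1,1)`:
`u_{(i,s)} = E₁₂^i H̃ + (-1)^s E₁₂^i E₁₃ H̃`. -/
noncomputable def uvec (k : ZMod 2 × ZMod 2) : V R :=
  coset R (E 0 1 (by decide) ^ k.1.val) +
    sgn R k.2 • coset R (E 0 1 (by decide) ^ k.1.val * E 0 2 (by decide))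


/-- The coset representatives `1, E₁₂, E₁₃, E₁₂ E₁₃`. -/
def base (i j : ZMod 2) : U4 := E 0 1 (by decide) ^ i.val * E 0 2 (by decide) ^ j.val

lemma base_entries : ∀ i j : ZMod 2, entry 0 1 (base i j) = i ∧ entry 0 2 (base i j) = j ∧
    entry 0 3 (base i j) = 0 ∧ entry 1 2 (base i j) = 0 ∧ entry 1 3 (base i j) = 0 ∧ entry 2 3 (base i j) = 0 := by
  decide

/-- The index `j` with `g ∈ E₁₂^i E₁₃^j H̃`. -/
def posn (g : U4) : ZMod 2 := entry 0 2 g + entry 0 1 g * entry 1 2 g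
/-- The exponent of the sign of `g ⊗ 1` relative to the representative of its coset. -/
def sg (g : U4) : ZMod 2 := entry 0 3 g + entry 0 1 g * entry 1 3 g + posn g * entry 2 3 g

lemma posn_mul (g h : U4) (h1 : entry 0 1 h = 0) (h2 : entry 0 2 h = 0) : posn (g * h) = posn g := by
  simp only [posn, a02_mul, a01_mul, a12_mul, h1, h2]
  linear_combination (entry 0 1 g * entry 1 2 h) * (CharTwo.two_eq_zero : (2 : ZMod 2) = 0)

lemma sg_mul (g h : U4) (h1 : entry 0 1 h = 0) (h2 : entry 0 2 h = 0) :
    sg (g * h) = sg g + entry 0 3 h := by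
  rw [sg, posn_mul g h h1 h2, sg]
  simp only [posn, a03_mul, a01_mul, a13_mul, a23_mul, h1, h2]
  linear_combination (entry 0 1 g * entry 1 3 h + entry 0 2 g * entry 2 3 h + entry 0 1 g * entry 1 2 g * entry 2 3 h)
    * (CharTwo.two_eq_zero : (2 : ZMod 2) = 0)

lemma coset_eq (g : U4) : coset R g = sgn R (sg g) • coset R (base (entry 0 1 g) (posn g)) := by
  obtain ⟨b1, b2, b3, b4, b5, b6⟩ := base_entries (entry 0 1 g) (posn g)
  have e : g = base (entry 0 1 g) (posn g) * ((base (entry 0 1 g) (posn g))⁻¹ * g) := by group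
  set b := base (entry 0 1 g) (posn g) with hb
  set h := b⁻¹ * g with hh
  have h1 : entry 0 1 h = 0 := by
    have := congrArg (entry 0 1) e
    rw [a01_mul, b1] at this
    simpa using this
  have h2 : entry 0 2 h = 0 := by
    have := congrArg (entry 0 2) e
    have t := congrArg (entry 1 2) e
    rw [a12_mul, b4, zero_add] at t
    rw [a02_mul, b1, b2, ← t, posn] at this
    linear_combination -this - (entry 0 1 g * entry 1 2 g) * (CharTwo.two_eq_zero : (2 : ZMod 2) = 0)
  have h3 : sg g = entry 0 3 h := by
    have := congrArg sg e
    rw [sg_mul b h h1 h2] at this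
    rw [this]
    simp [sg, b3, b5, b6]
  conv_lhs => rw [e]
  rw [h3]
  exact coset_mul R b ⟨h, h1, h2⟩

lemma uvec_eq (k : ZMod 2 × ZMod 2) : uvec R k =
    coset R (base k.1 0) + sgn R k.2 • coset R (base k.1 1) := by
  simp [uvec, base, ZMod.val_one]

lemma uvec_eq' (k : ZMod 2 × ZMod 2) (c : ZMod 2) : uvec R k =
    sgn R (k.2 * c) • coset R (base k.1 c) + sgn R (k.2 * (c + 1)) • coset R (base k.1 (c + 1)) := by
  rw [uvec_eq]
  have hc : c = 0 ∨ c = 1 := by revert c; decide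
  rcases hc with rfl | rfl
  · simp [sgn_zero]
  · rw [CharTwo.add_self_eq_zero, mul_zero, mul_one, sgn_zero, one_smul, add_comm]

/-- The permutation of the index set by which `g` permutes the lines spanned by the `u_k`. -/
def shift (g : U4) (k : ZMod 2 × ZMod 2) : ZMod 2 × ZMod 2 := (entry 0 1 g + k.1, entry 2 3 g + k.2)

/-- The exponent of the sign with which `g` maps `u_k` to `u_{shift g k}`. -/
def eps (g : U4) (k : ZMod 2 × ZMod 2) : ZMod 2 := sg (g * base k.1 0) + (entry 2 3 g + k.2) * posn (g * base k.1 0)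

lemma rhoV_uvec_aux (x0 x1 : U4) (i r s P T : ZMod 2)
    (q0 : coset R x0 = sgn R T • coset R (base i P))
    (q1 : coset R x1 = sgn R (T + r) • coset R (base i (P + 1))) :
    coset R x0 + sgn R s • coset R x1 = sgn R (T + (r + s) * P) • uvec R (i, r + s) := by
  rw [q0, q1, uvec_eq' R _ P]
  simp only [smul_add, smul_smul, ← sgn_add]
  congr 3
  · linear_combination (-(r + s) * P) * (CharTwo.two_eq_zero : (2 : ZMod 2) = 0)
  · linear_combination (-(r + s) * P) * (CharTwo.two_eq_zero : (2 : ZMod 2) = 0)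

lemma rhoV_uvec (g : U4) (k : ZMod 2 × ZMod 2) :
    ρV R g (uvec R k) = sgn R (eps g k) • uvec R (shift g k) := by
  obtain ⟨b1, b2, b3, b4, b5, b6⟩ := base_entries k.1 0
  obtain ⟨c1, c2, c3, c4, c5, c6⟩ := base_entries k.1 1
  have p1 : posn (g * base k.1 1) = posn (g * base k.1 0) + 1 := by
    simp only [posn, a01_mul, a02_mul, a12_mul, b1, b2, b4, c1, c2, c4]; ring
  have p2 : sg (g * base k.1 1) = sg (g * base k.1 0) + entry 2 3 g := by
    simp only [sg, p1, a01_mul, a03_mul, a13_mul, a23_mul, b1, b2, b3, b4, b5, b6, c1, c2, c3, c4, c5, c6]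
    ring
  have p3 : entry 0 1 (g * base k.1 0) = entry 0 1 g + k.1 := by rw [a01_mul, b1]
  have p4 : entry 0 1 (g * base k.1 1) = entry 0 1 g + k.1 := by rw [a01_mul, c1]
  rw [uvec_eq R k, (ρV R g).map_add, (ρV R g).map_smul, rhoV_coset, rhoV_coset]
  simp only [shift, eps]
  have q0 := coset_eq R (g * base k.1 0)
  have q1 := coset_eq R (g * base k.1 1)
  rw [p4, p2, p1] at q1
  rw [p3] at q0
  exact rhoV_uvec_aux R _ _ _ _ _ _ _ q0 q1

/-- The coordinates of `g ⊗ 1` with respect to the `u_k`. -/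
noncomputable def cf [Invertible (2 : R)] (g : U4) (k : ZMod 2 × ZMod 2) : R :=
  ⅟2 * (if k.1 = entry 0 1 g then sgn R (sg g + k.2 * posn g) else 0)

lemma cf_mul [Invertible (2 : R)] (g : U4) (h : Htilde) :
    cf R (g * h) = sgn R (entry 0 3 h) • cf R g := by
  funext k
  simp only [cf, Pi.smul_apply, smul_eq_mul, a01_mul, h.2.1, add_zero,
    posn_mul g h h.2.1 h.2.2, sg_mul g h h.2.1 h.2.2]
  split_ifs
  · simp only [sgn_add]; ring
  · ring

/-- The coordinates of an element of `V` with respect to the `u_k`. -/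
noncomputable def toCoord [Invertible (2 : R)] : V R →ₗ[R] (ZMod 2 × ZMod 2 → R) :=
  Representation.Coinvariants.lift _
    (TensorProduct.lift ((Finsupp.linearCombination R fun g : U4 =>
        LinearMap.toSpanSingleton R (ZMod 2 × ZMod 2 → R) (cf R g⁻¹)) ∘ₗ
      (MonoidAlgebra.coeffLinearEquiv R).toLinearMap)) (fun h => by
    ext g k
    have := congrFun (cf_mul R (h * g)⁻¹ h) k
    simp at this
    simp [sigma14, this])

lemma toCoord_coset [Invertible (2 : R)] (g : U4) : toCoord R (coset R g) = cf R g := by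
  simp [toCoord, coset]

lemma toCoord_uvec [Invertible (2 : R)] (k : ZMod 2 × ZMod 2) :
    toCoord R (uvec R k) = Pi.single k 1 := by
  obtain ⟨b1, b2, b3, b4, b5, b6⟩ := base_entries k.1 0
  obtain ⟨c1, c2, c3, c4, c5, c6⟩ := base_entries k.1 1
  rw [uvec_eq, map_add, map_smul, toCoord_coset, toCoord_coset]
  funext l
  simp only [Pi.add_apply, Pi.smul_apply, cf, b1, c1, sg, posn, b2, b3, b4, b5, b6, c2, c3, c4, c5, c6]
  obtain ⟨l1, l2⟩ := l
  obtain ⟨k1, k2⟩ := k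
  simp only [Pi.single_apply, Prod.mk.injEq]
  by_cases h : l1 = k1
  · subst h
    simp only [if_true, true_and, mul_zero, zero_mul, add_zero, zero_add, mul_one, sgn_zero,
      smul_eq_mul]
    by_cases h' : l2 = k2
    · subst h'
      rw [mul_left_comm, sgn_mul_self, if_pos rfl, mul_one, invOf_two_add_invOf_two]
    · have h2 : ∀ x y : ZMod 2, ¬ x = y → x = y + 1 := by decide
      rw [if_neg h', h2 l2 k2 h', sgn_add, mul_left_comm, ← mul_assoc (sgn R k2), sgn_mul_self]
      simp [sgn, ZMod.val_one]
  · simp [h]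

/-- The linear combination of the `u_k` with given coefficients. -/
noncomputable def ofCoord : (ZMod 2 × ZMod 2 → R) →ₗ[R] V R := Fintype.linearCombination R (uvec R)

lemma ofCoord_toCoord [Invertible (2 : R)] (v : V R) : ofCoord R (toCoord R v) = v := by
  have key : ∀ g, ofCoord R (toCoord R (coset R g)) = coset R g := fun g => by
    have hc : cf R g = fun k => (⅟2 * sgn R (sg g)) *
        (if k.1 = entry 0 1 g then sgn R (k.2 * posn g) else 0) := by
      funext k
      simp only [cf, sgn_add]
      split_ifs <;> ring
    have hs : ∀ c : ZMod 2, (∑ s : ZMod 2, sgn R (s * c) • uvec R (entry 0 1 g, s)) =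
        (2 : R) • coset R (base (entry 0 1 g) c) := by
      intro c
      change ∑ s : Fin 2, _ = _
      rw [Fin.sum_univ_two]
      change sgn R (0 * c) • uvec R (_, 0) + sgn R (1 * c) • uvec R (_, 1) = _
      have hc : c = 0 ∨ c = 1 := by revert c; decide
      rw [uvec_eq, uvec_eq]
      rcases hc with rfl | rfl
      · simp [sgn, ZMod.val_one, two_smul]; abel
      · simp [sgn, ZMod.val_one, two_smul]; abel
    rw [toCoord_coset, hc, ofCoord, Fintype.linearCombination_apply, Fintype.sum_prod_type,
      Finset.sum_eq_single (entry 0 1 g)]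
    · simp only [if_true, mul_smul]
      rw [← Finset.smul_sum, ← Finset.smul_sum, hs, smul_comm (sgn R _) (2 : R), smul_smul,
        invOf_mul_self, one_smul, ← coset_eq]
    · intro b _ hb
      simp [hb]
    · simp
  have : (ofCoord R) ∘ₗ (toCoord R) = LinearMap.id := by
    apply Representation.IndV.hom_ext
    intro g
    apply LinearMap.ext_ring
    have := key g⁻¹
    rw [coset, inv_inv] at this
    exact this
  exact LinearMap.congr_fun this v

/-- The basis `u₁, u₂, u₃, u₄` of `V` (here `2` is invertible in `R`). -/
noncomputable def uBasis [Invertible (2 : R)] : Module.Basis (ZMod 2 × ZMod 2) R (V R) :=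
  Module.Basis.ofEquivFun (LinearEquiv.ofLinearMap (toCoord R) (ofCoord R)
    (by ext k l; simp [ofCoord, toCoord_uvec, Fintype.linearCombination_apply_single])
    (LinearMap.ext fun v => ofCoord_toCoord R v))

lemma uBasis_apply [Invertible (2 : R)] (k : ZMod 2 × ZMod 2) : uBasis R k = uvec R k := by
  rw [uBasis, Module.Basis.coe_ofEquivFun]
  simp [ofCoord, Fintype.linearCombination_apply_single]

end

/-! ### Laurent polynomial rings: coordinate rings of powers of `𝔾_m` -/

/-- The Laurent polynomial ring `R[x_i, x_i⁻¹ : i ∈ σ]`, the coordinate ring of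
`𝔾_{m,R}^σ`. -/
def Laurent (R : Type u) [CommRing R] (σ : Type) [Fintype σ] : Type u :=
  Localization.Away (∏ i, MvPolynomial.X i : MvPolynomial σ R)

namespace Laurent

variable {R : Type u} [CommRing R] {σ : Type} [Fintype σ]

noncomputable instance : CommRing (Laurent R σ) :=
  inferInstanceAs (CommRing (Localization.Away (∏ i, MvPolynomial.X i : MvPolynomial σ R)))

noncomputable instance : Algebra R (Laurent R σ) :=
  inferInstanceAs (Algebra R (Localization.Away (∏ i, MvPolynomial.X i : MvPolynomial σ R)))

noncomputable instance : Algebra (MvPolynomial σ R) (Laurent R σ) :=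
  inferInstanceAs (Algebra (MvPolynomial σ R)
    (Localization.Away (∏ i, MvPolynomial.X i : MvPolynomial σ R)))

instance : IsScalarTower R (MvPolynomial σ R) (Laurent R σ) :=
  inferInstanceAs (IsScalarTower R (MvPolynomial σ R)
    (Localization.Away (∏ i, MvPolynomial.X i : MvPolynomial σ R)))

instance : IsLocalization.Away (∏ i, MvPolynomial.X i : MvPolynomial σ R) (Laurent R σ) :=
  inferInstanceAs (IsLocalization.Away _
    (Localization.Away (∏ i, MvPolynomial.X i : MvPolynomial σ R)))

/-- The coordinate `x_i`. -/
noncomputable def x (i : σ) : Laurent R σ := algebraMap (MvPolynomial σ R) _ (MvPolynomial.X i)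

lemma isUnit_x (i : σ) : IsUnit (x i : Laurent R σ) := by
  have h := IsLocalization.Away.algebraMap_isUnit (S := Laurent R σ)
    (∏ i, MvPolynomial.X i : MvPolynomial σ R)
  rw [map_prod] at h
  exact isUnit_of_dvd_unit (Finset.dvd_prod_of_mem _ (Finset.mem_univ i)) h

/-- The inverse of the coordinate `x_i`. -/
noncomputable def xinv (i : σ) : Laurent R σ := ↑(isUnit_x (R := R) i).unit⁻¹

lemma x_mul_xinv (i : σ) : (x i : Laurent R σ) * xinv i = 1 := (isUnit_x i).mul_val_inv

variable {T : Type u} [CommRing T] [Algebra R T]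

/-- The homomorphism that sends the coordinates `x_i` to given units `t_i`. -/
noncomputable def lift (t : σ → T) (ht : ∀ i, IsUnit (t i)) : Laurent R σ →ₐ[R] T :=
  IsLocalization.liftAlgHom (M := Submonoid.powers (∏ i, MvPolynomial.X i : MvPolynomial σ R))
    (f := MvPolynomial.aeval t) (by
      rintro ⟨_, n, rfl⟩
      rw [map_pow, map_prod]
      refine IsUnit.pow n ?_
      simpa [IsUnit.prod_univ_iff] using ht)

@[simp]
lemma lift_x (t : σ → T) (ht : ∀ i, IsUnit (t i)) (i : σ) :
    (lift t ht : Laurent R σ →ₐ[R] T) (x i) = t i := by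
  simp [lift, x]

lemma hom_ext {f g : Laurent R σ →ₐ[R] T} (h : ∀ i, f (x i) = g (x i)) : f = g := by
  apply IsLocalization.algHom_ext (Submonoid.powers (∏ i, MvPolynomial.X i : MvPolynomial σ R))
  ext i
  exact h i

end Laurent

/-! ### The `U₄`-scheme `𝔾_m⁴ × 𝓛` -/

section
variable (R : Type u) [CommRing R]

lemma isUnit_sgn (x : ZMod 2) : IsUnit (sgn R x) := IsUnit.of_mul_eq_one _ (sgn_mul_self R x)

/-- The matrix of the action of `g` on `V` in the basis `u₁, u₂, u₃, u₄`: its entry at `(k, l)`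
is `u_k^*(g u_l)`. -/
noncomputable def repMatrix [Invertible (2 : R)] (g : U4) :
    Matrix (ZMod 2 × ZMod 2) (ZMod 2 × ZMod 2) R :=
  LinearMap.toMatrix (uBasis R) (uBasis R) (ρV R g)

lemma shift_shift (g : U4) (k : ZMod 2 × ZMod 2) : shift g (shift g k) = k := by
  simp [shift, ← add_assoc, CharTwo.add_self_eq_zero]

lemma repMatrix_apply [Invertible (2 : R)] (g : U4) (k l : ZMod 2 × ZMod 2) :
    repMatrix R g k l = if l = shift g k then sgn R (eps g l) else 0 := by
  rw [repMatrix, LinearMap.toMatrix_apply, uBasis_apply, rhoV_uvec, ← uBasis_apply, map_smul,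
    Module.Basis.repr_self, Finsupp.smul_single, Finsupp.single_apply, smul_eq_mul, mul_one]
  refine if_congr ⟨fun h => ?_, fun h => ?_⟩ rfl rfl
  · rw [← h, shift_shift]
  · rw [h, shift_shift]

lemma sum_repMatrix [Invertible (2 : R)] {A : Type*} [AddCommGroup A] [Module R A] (g : U4)
    (k : ZMod 2 × ZMod 2) (v : ZMod 2 × ZMod 2 → A) :
    ∑ l, repMatrix R g k l • v l = sgn R (eps g (shift g k)) • v (shift g k) := by
  rw [Finset.sum_eq_single (shift g k)]
  · rw [repMatrix_apply, if_pos rfl]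
  · intro l _ hl
    rw [repMatrix_apply, if_neg hl, zero_smul]
  · simp

/-- The coordinate ring `R[u_k^*, (u_k^*)⁻¹]` of `𝔾_m⁴`, the complement of the zero locus of
`u₁^* u₂^* u₃^* u₄^*` in `𝓥 = Spec (Sym V^*) = Spec R[u₁^*, u₂^*, u₃^*, u₄^*]`. -/
abbrev OG : Type u := Laurent R (ZMod 2 × ZMod 2)

/-- The coordinate ring `R[α, α⁻¹, β, β⁻¹, γ, γ⁻¹]` of `𝓛`; the coordinates
`α, β, γ` have the indices `0, 1, 2`. -/
abbrev OL : Type u := Laurent R (Fin 3)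

/-- The group `(ℤ/2)³`, written multiplicatively. -/
abbrev K : Type := Multiplicative (Fin 3 → ZMod 2)

/-- The homomorphism `q = a₁₂ × a₂₃ × a₃₄ : U₄ → (ℤ/2)³`. -/
def q : U4 →* K where
  toFun g := Multiplicative.ofAdd ![entry 0 1 g, entry 1 2 g, entry 2 3 g]
  map_one' := by decide
  map_mul' g h := by rw [a01_mul, a12_mul, a23_mul, ← ofAdd_add]; simp

/-- The action of `U₄` on the functions on `𝔾_m⁴ ⊂ 𝓥` induced by the representation `V`:
`g • u_k^* = u_k^* ∘ g⁻¹ = ∑_l u_k^*(g⁻¹ u_l) u_l^*`. -/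
noncomputable def actG [Invertible (2 : R)] : U4 →* (OG R →ₐ[R] OG R) where
  toFun g := Laurent.lift (fun k => ∑ l, repMatrix R g⁻¹ k l • Laurent.x l) (fun k => by
    rw [sum_repMatrix, Algebra.smul_def]
    exact ((isUnit_sgn R _).map _).mul (Laurent.isUnit_x _))
  map_one' := by
    apply Laurent.hom_ext
    intro k
    rw [Laurent.lift_x]
    simp [repMatrix, Matrix.one_apply]
  map_mul' g h := by
    apply Laurent.hom_ext
    intro k
    have : repMatrix R (g * h)⁻¹ = repMatrix R h⁻¹ * repMatrix R g⁻¹ := by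
      rw [repMatrix, mul_inv_rev, map_mul]
      exact LinearMap.toMatrix_mul _ _ _
    rw [Laurent.lift_x, AlgHom.mul_apply, Laurent.lift_x, map_sum]
    simp only [map_smul, Laurent.lift_x, this, Matrix.mul_apply, Finset.sum_smul,
      Finset.smul_sum, smul_smul]
    exact Finset.sum_comm

lemma actG_x [Invertible (2 : R)] (g : U4) (k : ZMod 2 × ZMod 2) :
    actG R g (Laurent.x k) = ∑ l, repMatrix R g⁻¹ k l • Laurent.x l := by
  simp only [actG, MonoidHom.coe_mk, OneHom.coe_mk, Laurent.lift_x]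

/-- The action of `(ℤ/2)³` on the functions on `𝓛` by signs on `α, β, γ`. -/
noncomputable def actL : K →* (OL R →ₐ[R] OL R) where
  toFun h := Laurent.lift (fun i => sgn R (Multiplicative.toAdd h i) • Laurent.x i) (fun k => by
    rw [Algebra.smul_def]
    exact ((isUnit_sgn R _).map _).mul (Laurent.isUnit_x _))
  map_one' := by
    apply Laurent.hom_ext
    intro k
    rw [Laurent.lift_x]
    simp [sgn]
  map_mul' g h := by
    apply Laurent.hom_ext
    intro k
    rw [Laurent.lift_x, AlgHom.mul_apply, Laurent.lift_x, map_smul, Laurent.lift_x, smul_smul,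
      toAdd_mul, Pi.add_apply, sgn_add, mul_comm]

lemma actL_x (h : K) (i : Fin 3) :
    actL R h (Laurent.x i) = sgn R (Multiplicative.toAdd h i) • Laurent.x i := by
  simp only [actL, MonoidHom.coe_mk, OneHom.coe_mk, Laurent.lift_x]

/-- The coordinate ring of `𝔾_m⁴ × 𝓛` (product over `Spec R`). -/
abbrev OP : Type u := OG R ⊗[R] OL R

/-- The diagonal action of `U₄` on the functions on `𝔾_m⁴ × 𝓛`; on the second factor `U₄`
acts through `q`, so `α, β, γ` are multiplied by `(-1)^{a₁₂}, (-1)^{a₂₃}, (-1)^{a₃₄}`. -/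
noncomputable def actP [Invertible (2 : R)] : U4 →* (OP R →ₐ[R] OP R) where
  toFun g := Algebra.TensorProduct.map (actG R g) (actL R (q g))
  map_one' := by rw [map_one, map_one, map_one]; exact Algebra.TensorProduct.map_id
  map_mul' g h := by rw [map_mul, map_mul, map_mul]; exact Algebra.TensorProduct.map_comp _ _ _ _

/-! ### The Kummer torsor `𝓛 → L_a × L_b × L_c` -/

/-- The coordinate ring `R[a, a⁻¹, b, b⁻¹, c, c⁻¹]` of `L_a × L_b × L_c`; the coordinates
`a, b, c` have the indices `0, 1, 2`. -/
abbrev Oabc : Type u := Laurent R (Fin 3)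

/-- The comorphism `a ↦ α², b ↦ β², c ↦ γ²` of `𝓛 → L_a × L_b × L_c`. -/
noncomputable def kummer : Oabc R →ₐ[R] OL R :=
  Laurent.lift (fun i => Laurent.x i ^ 2) (fun i => (Laurent.isUnit_x i).pow 2)

lemma kummer_invariant (h : K) (z : Oabc R) : actL R h (kummer R z) = kummer R z := by
  suffices hh : (actL R h).comp (kummer R) = kummer R from DFunLike.congr_fun hh z
  apply Laurent.hom_ext
  intro i
  simp only [AlgHom.comp_apply, kummer, actL, Laurent.lift_x, map_pow, MonoidHom.coe_mk,
    OneHom.coe_mk, smul_pow]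
  rw [sq (sgn R _), sgn_mul_self, one_smul]

/-! ### The scheme `𝓧` -/

/-- The norm of `y₁ + y_α α + y_γ γ + y_{αγ} α γ` written in `a = α²` and `c = γ²`. -/
def normPoly {S : Type*} [CommRing S] (a c y1 yα yγ yαγ : S) : S :=
  (y1 ^ 2 - a * yα ^ 2 + c * yγ ^ 2 - a * c * yαγ ^ 2) ^ 2
    - c * (2 * y1 * yγ - 2 * a * yα * yαγ) ^ 2

lemma normPoly_eq_prod {S : Type*} [CommRing S] (α γ y1 yα yγ yαγ : S) :
    normPoly (α ^ 2) (γ ^ 2) y1 yα yγ yαγ =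
      ∏ i : Fin 2, ∏ j : Fin 2, (y1 + (-1) ^ (i : ℕ) * yα * α + (-1) ^ (j : ℕ) * yγ * γ +
        (-1) ^ ((i : ℕ) + (j : ℕ)) * yαγ * (α * γ)) := by
  simp [Fin.prod_univ_two, normPoly]
  ring

/-- The coordinate ring `R[a, a⁻¹, c, c⁻¹]` of `S = L_a × L_c`; the coordinates `a, c` have
the indices `0, 1`. -/
abbrev OS : Type u := Laurent R (Fin 2)

/-- The norm `N_{S'/S}(y)` of the general element `y = y₁ + y_α α + y_γ γ + y_{αγ} α γ`;
the coordinates `y₁, y_α, y_γ, y_{αγ}` have the indices `0, 1, 2, 3`. -/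
noncomputable def resNorm : MvPolynomial (Fin 4) (OS R) :=
  normPoly (.C (Laurent.x 0)) (.C (Laurent.x 1)) (.X 0) (.X 1) (.X 2) (.X 3)

/-- The coordinate ring of the restriction of scalars `Res_{S'/S} 𝔾_{m,S'}`, where
`S' = Spec R[α, α⁻¹, γ, γ⁻¹]`, `a = α²`, `c = γ²`: the open subscheme of `𝔸⁴_S` (the
restriction of scalars of `𝔸¹`, with the coordinates of `y` in the basis `1, α, γ, αγ`)
where `N_{S'/S}(y)` is invertible. See `ORes_represents` for its universal property. -/
def ORes : Type u := Localization.Away (resNorm R)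

noncomputable instance : CommRing (ORes R) :=
  inferInstanceAs (CommRing (Localization.Away (resNorm R)))

noncomputable instance : Algebra R (ORes R) :=
  inferInstanceAs (Algebra R (Localization.Away (resNorm R)))

noncomputable instance : Algebra (MvPolynomial (Fin 4) (OS R)) (ORes R) :=
  inferInstanceAs (Algebra (MvPolynomial (Fin 4) (OS R)) (Localization.Away (resNorm R)))

instance : IsScalarTower R (MvPolynomial (Fin 4) (OS R)) (ORes R) :=
  inferInstanceAs (IsScalarTower R (MvPolynomial (Fin 4) (OS R)) (Localization.Away (resNorm R)))

instance : IsLocalization.Away (resNorm R) (ORes R) :=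
  inferInstanceAs (IsLocalization.Away (resNorm R) (Localization.Away (resNorm R)))

noncomputable instance : Algebra (OS R) (ORes R) :=
  inferInstanceAs (Algebra (OS R) (Localization.Away (resNorm R)))

instance : IsScalarTower (OS R) (MvPolynomial (Fin 4) (OS R)) (ORes R) :=
  inferInstanceAs (IsScalarTower (OS R) (MvPolynomial (Fin 4) (OS R))
    (Localization.Away (resNorm R)))

/-- The coordinate ring `R[α, α⁻¹, γ, γ⁻¹]` of `S'`; the coordinates `α, γ` have the
indices `false, true`. -/
abbrev OS' : Type u := Laurent R Bool

/-- The comorphism `a ↦ α²`, `c ↦ γ²` of `S' → S`. -/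
noncomputable def sqS : OS R →ₐ[R] OS' R :=
  Laurent.lift ![Laurent.x false ^ 2, Laurent.x true ^ 2] (by
    intro i
    fin_cases i
    · exact (Laurent.isUnit_x false).pow 2
    · exact (Laurent.isUnit_x true).pow 2)

lemma sqS_x0 : sqS R (Laurent.x 0) = Laurent.x false ^ 2 := by
  simp [sqS]

lemma sqS_x1 : sqS R (Laurent.x 1) = Laurent.x true ^ 2 := by
  simp [sqS]

/-- The structure of `S' → S`. -/
noncomputable instance : Algebra (OS R) (OS' R) := (sqS R).toRingHom.toAlgebra

lemma smul_eq_sqS (s : OS R) (z : OS' R) : s • z = sqS R s * z := Algebra.smul_def _ _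

lemma sqS_injective : Function.Injective (sqS R) := by
  rw [injective_iff_map_eq_zero]
  intro s hs
  obtain ⟨⟨p, ⟨_, n, rfl⟩⟩, h⟩ := IsLocalization.surj
    (Submonoid.powers (∏ i, MvPolynomial.X i : MvPolynomial (Fin 2) R)) s
  have key : ∀ r : MvPolynomial (Fin 2) R, sqS R (algebraMap _ (OS R) r) =
      algebraMap _ (OS' R) (MvPolynomial.expand 2 (MvPolynomial.rename ![false, true] r)) := by
    intro r
    have : (sqS R).comp (IsScalarTower.toAlgHom R (MvPolynomial (Fin 2) R) (OS R)) =
        (IsScalarTower.toAlgHom R (MvPolynomial Bool R) (OS' R)).comp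
          ((MvPolynomial.expand 2).comp (MvPolynomial.rename ![false, true])) := by
      apply MvPolynomial.algHom_ext
      intro i
      simp only [AlgHom.comp_apply, IsScalarTower.coe_toAlgHom', MvPolynomial.rename_X,
        MvPolynomial.expand_X, map_pow]
      fin_cases i
      · exact sqS_x0 R
      · exact sqS_x1 R
    exact DFunLike.congr_fun this r
  have h2 := congrArg (sqS R) h
  rw [map_mul, hs, zero_mul, key] at h2
  have hinj : Function.Injective (algebraMap (MvPolynomial Bool R) (OS' R)) := by
    refine IsLocalization.injective (M := Submonoid.powers (∏ i, MvPolynomial.X i)) _ ?_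
    refine Submonoid.powers_le.mpr ?_
    exact (MvPolynomial.isRegular_prod_X _).mem_nonZeroDivisors
  have h3 : p = 0 := by
    have h4 := (MvPolynomial.expand_eq_zero two_pos).mp (hinj (h2.symm.trans (map_zero _).symm))
    exact MvPolynomial.rename_injective _ (by decide) (h4.trans (map_zero _).symm)
  simp only [h3, map_zero] at h
  exact (IsLocalization.map_units (OS R) (⟨_, n, rfl⟩ : Submonoid.powers
    (∏ i, MvPolynomial.X i : MvPolynomial (Fin 2) R))).mul_left_eq_zero.mp h

/-- The automorphism `α ↦ (-1)^{s₀} α`, `γ ↦ (-1)^{s₁} γ` of `S'` over `Spec R`. -/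
noncomputable def conjR (s : Bool → ZMod 2) : OS' R →ₐ[R] OS' R :=
  Laurent.lift (fun i => sgn R (s i) • Laurent.x i) (fun i => by
    rw [Algebra.smul_def]
    exact ((isUnit_sgn R _).map _).mul (Laurent.isUnit_x _))

lemma conjR_x (s : Bool → ZMod 2) (i : Bool) :
    conjR R s (Laurent.x i) = sgn R (s i) • Laurent.x i :=
  Laurent.lift_x _ _ i

lemma conjR_sqS (s : Bool → ZMod 2) (z : OS R) : conjR R s (sqS R z) = sqS R z := by
  suffices h : (conjR R s).comp (sqS R) = sqS R from DFunLike.congr_fun h z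
  apply Laurent.hom_ext
  intro i
  rw [AlgHom.comp_apply]
  fin_cases i
  · change conjR R s (sqS R (Laurent.x 0)) = sqS R (Laurent.x 0)
    rw [sqS_x0, map_pow, conjR_x, smul_pow, sq (sgn R _), sgn_mul_self, one_smul]
  · change conjR R s (sqS R (Laurent.x 1)) = sqS R (Laurent.x 1)
    rw [sqS_x1, map_pow, conjR_x, smul_pow, sq (sgn R _), sgn_mul_self, one_smul]

/-- The same automorphism, over `S`. -/
noncomputable def conjS (s : Bool → ZMod 2) : OS' R →ₐ[OS R] OS' R :=
  { (conjR R s).toRingHom with commutes' := conjR_sqS R s }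

lemma conjS_x (s : Bool → ZMod 2) (i : Bool) :
    conjS R s (Laurent.x i) = sgn R (s i) • Laurent.x i :=
  conjR_x R s i

/-- The elements `1, α, γ, αγ`. -/
noncomputable def e4 : Fin 4 → OS' R :=
  ![1, Laurent.x false, Laurent.x true, Laurent.x false * Laurent.x true]

lemma e4_isUnit (k : Fin 4) : IsUnit (e4 R k) := by
  fin_cases k
  · exact isUnit_one
  · exact Laurent.isUnit_x false
  · exact Laurent.isUnit_x true
  · exact (Laurent.isUnit_x false).mul (Laurent.isUnit_x true)

lemma conjS_e4 (s : Bool → ZMod 2) (k : Fin 4) : conjS R s (e4 R k) =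
    ![1, sgn R (s false), sgn R (s true), sgn R (s false + s true)] k • e4 R k := by
  fin_cases k
  · exact (map_one _).trans (one_smul _ _).symm
  · exact conjS_x R s false
  · exact conjS_x R s true
  · change conjS R s (Laurent.x false * Laurent.x true) =
      sgn R (s false + s true) • (Laurent.x false * Laurent.x true)
    rw [map_mul, conjS_x, conjS_x, smul_mul_smul_comm, sgn_add]

lemma linearIndependent_e4 [Invertible (2 : R)] : LinearIndependent (OS R) (e4 R) := by
  rw [Fintype.linearIndependent_iff]
  intro s hs
  have hc : ∀ t : Bool → ZMod 2, ∑ k, sqS R (s k) *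
      (algebraMap R (OS' R) (![1, sgn R (t false), sgn R (t true),
        sgn R (t false + t true)] k) * e4 R k) = 0 := by
    intro t
    have := congrArg (conjS R t) hs
    rw [map_sum, map_zero] at this
    rw [← this]
    refine Finset.sum_congr rfl fun k _ => ?_
    rw [map_smul, conjS_e4, smul_eq_sqS, Algebra.smul_def]
  have h00 := hc (fun _ => 0)
  have h01 := hc (fun i => if i then 1 else 0)
  have h10 := hc (fun i => if i then 0 else 1)
  have h11 := hc (fun _ => 1)
  have e : (1 : ZMod 2) + 1 = 0 := rfl
  have e1 : sgn R 1 = -1 := by simp [sgn, ZMod.val_one]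
  simp only [Fin.sum_univ_four, Matrix.cons_val_zero, Matrix.cons_val_one, Matrix.cons_val,
    if_true, if_false, Bool.false_eq_true,
    e, e1, sgn_zero, add_zero, zero_add, map_neg, map_one, one_mul, neg_mul, mul_neg]
    at h00 h01 h10 h11
  have h4 : IsUnit (4 : OS' R) := by
    have := ((isUnit_of_invertible (2 : R)).mul (isUnit_of_invertible (2 : R))).map
      (algebraMap R (OS' R))
    rw [map_mul, map_ofNat] at this
    convert this using 1
    norm_num
  have key : ∀ k, 4 * (sqS R (s k) * e4 R k) = 0 → s k = 0 := by
    intro k hk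
    have h := (h4.mul_right_eq_zero).mp hk
    exact (injective_iff_map_eq_zero _).mp (sqS_injective R) _
      (((e4_isUnit R k).mul_left_eq_zero).mp h)
  intro k
  apply key
  fin_cases k
  · change 4 * (sqS R (s 0) * e4 R 0) = 0
    linear_combination h00 + h01 + h10 + h11
  · change 4 * (sqS R (s 1) * e4 R 1) = 0
    linear_combination h00 + h01 - h10 - h11
  · change 4 * (sqS R (s 2) * e4 R 2) = 0
    linear_combination h00 - h01 + h10 - h11
  · change 4 * (sqS R (s 3) * e4 R 3) = 0
    linear_combination h00 - h01 - h10 + h11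

lemma span_mul_x (i : Bool) (z : OS' R) (hz : z ∈ Submodule.span (OS R) (Set.range (e4 R))) :
    Laurent.x i * z ∈ Submodule.span (OS R) (Set.range (e4 R)) := by
  have hb : ∀ k, e4 R k ∈ Submodule.span (OS R) (Set.range (e4 R)) := fun k =>
    Submodule.subset_span ⟨k, rfl⟩
  have hb0 : (1 : OS' R) ∈ _ := hb 0
  have hb1 : (Laurent.x false : OS' R) ∈ _ := hb 1
  have hb2 : (Laurent.x true : OS' R) ∈ _ := hb 2
  have hb3 : (Laurent.x false * Laurent.x true : OS' R) ∈ _ := hb 3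
  have hf : ∀ z, z ∈ Submodule.span (OS R) (Set.range (e4 R)) →
      Laurent.x false * (Laurent.x false * z) ∈ Submodule.span (OS R) (Set.range (e4 R)) := by
    intro z hz
    rw [← mul_assoc, ← sq, ← sqS_x0, ← smul_eq_sqS]
    exact Submodule.smul_mem _ _ hz
  have ht : ∀ z, z ∈ Submodule.span (OS R) (Set.range (e4 R)) →
      Laurent.x true * (Laurent.x true * z) ∈ Submodule.span (OS R) (Set.range (e4 R)) := by
    intro z hz
    rw [← mul_assoc, ← sq, ← sqS_x1, ← smul_eq_sqS]
    exact Submodule.smul_mem _ _ hz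
  induction hz using Submodule.span_induction with
  | mem z hz =>
    obtain ⟨k, rfl⟩ := hz
    cases i <;> fin_cases k
    · change Laurent.x false * 1 ∈ _
      rwa [mul_one]
    · have := hf _ hb0
      rwa [mul_one] at this
    · exact hb3
    · exact hf _ hb2
    · change Laurent.x true * 1 ∈ _
      rwa [mul_one]
    · change Laurent.x true * Laurent.x false ∈ _
      rwa [mul_comm]
    · have := ht _ hb0
      rwa [mul_one] at this
    · have := ht _ hb1
      rwa [mul_comm (Laurent.x true) (Laurent.x false)] at this
  | zero => rw [mul_zero]; exact zero_mem _
  | add a b _ _ ha hb => rw [mul_add]; exact add_mem ha hb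
  | smul r a _ ha => rw [mul_smul_comm]; exact Submodule.smul_mem _ _ ha

lemma span_e4 : ⊤ ≤ Submodule.span (OS R) (Set.range (e4 R)) := by
  intro z _
  have hpoly : ∀ p : MvPolynomial Bool R, algebraMap _ (OS' R) p ∈
      Submodule.span (OS R) (Set.range (e4 R)) := by
    intro p
    induction p using MvPolynomial.induction_on with
    | C r =>
      have : algebraMap _ (OS' R) (MvPolynomial.C r : MvPolynomial Bool R) =
          algebraMap R (OS R) r • e4 R 0 := by
        rw [smul_eq_sqS, AlgHom.commutes]
        exact (IsScalarTower.algebraMap_apply R (MvPolynomial Bool R) (OS' R) r).symm.trans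
          (mul_one _).symm
      rw [this]
      exact Submodule.smul_mem _ _ (Submodule.subset_span ⟨0, rfl⟩)
    | add p r hp hr => rw [map_add]; exact add_mem hp hr
    | mul_X p i hp =>
      rw [map_mul, mul_comm]
      exact span_mul_x R i _ hp
  have key : ∀ (n : ℕ) (z : OS' R),
      z * (Laurent.x true * Laurent.x false) ^ n ∈ Submodule.span (OS R) (Set.range (e4 R)) →
      z ∈ Submodule.span (OS R) (Set.range (e4 R)) := by
    intro n
    induction n with
    | zero => intro z hz; simpa using hz
    | succ n ih =>
      intro z hz
      apply ih
      have h1 := Submodule.smul_mem _ (Laurent.xinv 0 * Laurent.xinv 1 : OS R)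
        (span_mul_x R false _ (span_mul_x R true _ hz))
      convert h1 using 1
      rw [smul_eq_sqS, map_mul]
      have h0 : Laurent.x false ^ 2 * sqS R (Laurent.xinv 0) = 1 := by
        rw [← sqS_x0, ← map_mul, Laurent.x_mul_xinv, map_one]
      have h1 : Laurent.x true ^ 2 * sqS R (Laurent.xinv 1) = 1 := by
        rw [← sqS_x1, ← map_mul, Laurent.x_mul_xinv, map_one]
      calc _ = z * (Laurent.x true * Laurent.x false) ^ n * (1 * 1) := by ring
        _ = z * (Laurent.x true * Laurent.x false) ^ n *
            ((Laurent.x false ^ 2 * sqS R (Laurent.xinv 0)) *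
              (Laurent.x true ^ 2 * sqS R (Laurent.xinv 1))) := by rw [h0, h1]
        _ = _ := by ring
  obtain ⟨⟨p, ⟨_, n, rfl⟩⟩, h⟩ := IsLocalization.surj
    (Submonoid.powers (∏ i, MvPolynomial.X i : MvPolynomial Bool R)) z
  apply key n
  convert hpoly p using 1
  rw [← h, map_pow, map_prod, Fintype.prod_bool]
  rfl

/-- The basis `1, α, γ, αγ` of the coordinate ring of `S'` over that of `S`. -/
noncomputable def basisS [Invertible (2 : R)] : Module.Basis (Fin 4) (OS R) (OS' R) :=
  Module.Basis.mk (linearIndependent_e4 R) (span_e4 R)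

/-- The element `t₀ + t₁ α + t₂ γ + t₃ αγ` of `T ⊗_S S'`. -/
noncomputable def ofTuple (T : Type u) [CommRing T] [Algebra (OS R) T] (t : Fin 4 → T) :
    T ⊗[OS R] OS' R := ∑ k, t k ⊗ₜ e4 R k

lemma ofTuple_bijective [Invertible (2 : R)] (T : Type u) [CommRing T] [Algebra (OS R) T] :
    Function.Bijective (ofTuple R T) := by
  have : ofTuple R T = (Algebra.TensorProduct.basis T (basisS R)).equivFun.symm := by
    funext t
    rw [Module.Basis.equivFun_symm_apply, ofTuple]
    refine Finset.sum_congr rfl fun k _ => ?_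
    rw [Algebra.TensorProduct.basis_apply, TensorProduct.smul_tmul', basisS, Module.Basis.mk_apply,
      smul_eq_mul, mul_one]
  rw [this]
  exact LinearEquiv.bijective _

/-- The norm of `t₀ + t₁ α + t₂ γ + t₃ αγ`. -/
noncomputable def normT (T : Type u) [CommRing T] [Algebra (OS R) T] (t : Fin 4 → T) : T :=
  normPoly (algebraMap (OS R) T (Laurent.x 0)) (algebraMap (OS R) T (Laurent.x 1))
    (t 0) (t 1) (t 2) (t 3)

lemma normT_tmul (T : Type u) [CommRing T] [Algebra (OS R) T] (t : Fin 4 → T) :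
    normT R T t ⊗ₜ[OS R] (1 : OS' R) =
      ∏ i : Fin 2, ∏ j : Fin 2, Algebra.TensorProduct.map (AlgHom.id (OS R) T)
        (conjS R fun b => if b then ((j : ℕ) : ZMod 2) else ((i : ℕ) : ZMod 2))
          (ofTuple R T t) := by
  have e1 : sgn R 1 = -1 := by simp [sgn, ZMod.val_one]
  have e : (1 : ZMod 2) + 1 = 0 := rfl
  let ι : T →ₐ[OS R] T ⊗[OS R] OS' R := Algebra.TensorProduct.includeLeft
  let κ : OS' R →ₐ[OS R] T ⊗[OS R] OS' R := Algebra.TensorProduct.includeRight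
  have ha : ι (algebraMap (OS R) T (Laurent.x 0)) = κ (Laurent.x false) ^ 2 := by
    rw [AlgHom.commutes, ← map_pow, ← sqS_x0]
    exact (κ.commutes _).symm
  have hc : ι (algebraMap (OS R) T (Laurent.x 1)) = κ (Laurent.x true) ^ 2 := by
    rw [AlgHom.commutes, ← map_pow, ← sqS_x1]
    exact (κ.commutes _).symm
  have hy : ∀ s : Bool → ZMod 2, Algebra.TensorProduct.map (AlgHom.id (OS R) T)
      (conjS R s) (ofTuple R T t) = ι (t 0) +
      ι (t 1) * κ (conjS R s (Laurent.x false)) + ι (t 2) * κ (conjS R s (Laurent.x true)) +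
      ι (t 3) * (κ (conjS R s (Laurent.x false)) * κ (conjS R s (Laurent.x true))) := by
    intro s
    rw [ofTuple, map_sum, Fin.sum_univ_four]
    simp only [Algebra.TensorProduct.map_tmul, AlgHom.id_apply, e4, Matrix.cons_val_zero,
      Matrix.cons_val_one, Matrix.cons_val, map_one, map_mul, ι, κ,
      Algebra.TensorProduct.includeLeft_apply, Algebra.TensorProduct.includeRight_apply,
      Algebra.TensorProduct.tmul_mul_tmul, mul_one, one_mul]
  have hn : normT R T t ⊗ₜ[OS R] (1 : OS' R) =
      normPoly (κ (Laurent.x false) ^ 2) (κ (Laurent.x true) ^ 2)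
        (ι (t 0)) (ι (t 1)) (ι (t 2)) (ι (t 3)) := by
    rw [← ha, ← hc]
    change ι _ = _
    simp only [normT, normPoly, map_sub, map_mul, map_pow, map_add, map_ofNat]
  rw [hn, normPoly_eq_prod]
  refine Finset.prod_congr rfl fun i _ => Finset.prod_congr rfl fun j _ => ?_
  rw [hy, conjS_x, conjS_x]
  fin_cases i <;> fin_cases j <;> simp [e1, sgn_zero]

lemma isUnit_ofTuple [Invertible (2 : R)] (T : Type u) [CommRing T] [Algebra (OS R) T]
    (t : Fin 4 → T) : IsUnit (ofTuple R T t) ↔ IsUnit (normT R T t) := by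
  constructor
  · intro h
    have h1 : IsUnit (normT R T t ⊗ₜ[OS R] (1 : OS' R)) := by
      rw [normT_tmul]
      simp only [IsUnit.prod_univ_iff]
      exact fun i j => h.map _
    obtain ⟨z, hz⟩ := h1.exists_right_inv
    obtain ⟨s, rfl⟩ := (ofTuple_bijective R T).2 z
    have h2 : ofTuple R T (fun k => normT R T t * s k) = ofTuple R T (Pi.single 0 1) := by
      have h3 : ofTuple R T (Pi.single 0 1) = 1 := by
        rw [ofTuple, Finset.sum_eq_single 0]
        · rw [Pi.single_eq_same]; rfl
        · intro k _ hk; rw [Pi.single_eq_of_ne hk, TensorProduct.zero_tmul]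
        · simp
      rw [h3, ← hz, ofTuple, ofTuple, Finset.mul_sum]
      simp only [Algebra.TensorProduct.tmul_mul_tmul, one_mul]
    have h4 := congrFun ((ofTuple_bijective R T).1 h2) 0
    exact IsUnit.of_mul_eq_one _ (h4.trans (Pi.single_eq_same _ _))
  · intro h
    have h1 : IsUnit (normT R T t ⊗ₜ[OS R] (1 : OS' R)) :=
      h.map (Algebra.TensorProduct.includeLeft : T →ₐ[OS R] T ⊗[OS R] OS' R)
    rw [normT_tmul] at h1
    simp only [IsUnit.prod_univ_iff] at h1
    have h2 := h1 0 0
    have h3 : conjS R (fun b => if b then (((0 : Fin 2) : ℕ) : ZMod 2) else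
        (((0 : Fin 2) : ℕ) : ZMod 2)) = AlgHom.id (OS R) (OS' R) := by
      have h4 : conjR R (fun b => if b then (((0 : Fin 2) : ℕ) : ZMod 2) else
          (((0 : Fin 2) : ℕ) : ZMod 2)) = AlgHom.id R (OS' R) := by
        apply Laurent.hom_ext
        intro i
        rw [conjR_x]
        simp [sgn_zero]
      exact AlgHom.ext fun z => DFunLike.congr_fun h4 z
    rw [h3, Algebra.TensorProduct.map_id] at h2
    exact h2

/-- The coordinates `y₁, y_α, y_γ, y_{αγ}` on `Res_{S'/S} 𝔾_{m,S'}`. -/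
noncomputable def yRes (k : Fin 4) : ORes R :=
  algebraMap (MvPolynomial (Fin 4) (OS R)) (ORes R) (.X k)

/-- `Spec (ORes R)` is the restriction of scalars `Res_{S'/S} 𝔾_{m,S'}`: it represents the functor
`T ↦ (T ⊗_S S')^×` on `S`-algebras, and `y₁ + y_α α + y_γ γ + y_{αγ} α γ` is the universal
unit. -/
lemma ORes_represents [Invertible (2 : R)] :
    IsUnit (ofTuple R (ORes R) (yRes R)) ∧
    ∀ (T : Type u) [CommRing T] [Algebra (OS R) T] (z : T ⊗[OS R] OS' R), IsUnit z →
      ∃! φ : ORes R →ₐ[OS R] T,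
        Algebra.TensorProduct.map φ (AlgHom.id (OS R) (OS' R)) (ofTuple R (ORes R) (yRes R))
          = z := by
  constructor
  · rw [isUnit_ofTuple]
    convert IsLocalization.Away.algebraMap_isUnit (S := ORes R) (resNorm R) using 1
    simp only [normT, resNorm, normPoly, map_sub, map_mul, map_pow, map_add, map_ofNat, yRes]
    rfl
  · intro T _ _ z hz
    obtain ⟨t, rfl⟩ := (ofTuple_bijective R T).2 z
    have hm : ∀ φ : ORes R →ₐ[OS R] T, Algebra.TensorProduct.map φ (AlgHom.id (OS R) (OS' R))
        (ofTuple R (ORes R) (yRes R)) = ofTuple R T (fun k => φ (yRes R k)) := by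
      intro φ
      simp only [ofTuple, map_sum, Algebra.TensorProduct.map_tmul, AlgHom.id_apply]
    rw [isUnit_ofTuple] at hz
    have hn : MvPolynomial.aeval t (resNorm R) = normT R T t := by
      simp only [normT, resNorm, normPoly, map_sub, map_mul, map_pow, map_add, map_ofNat,
        MvPolynomial.aeval_X, MvPolynomial.aeval_C]
    let φ : ORes R →ₐ[OS R] T := IsLocalization.liftAlgHom
      (M := Submonoid.powers (resNorm R)) (f := MvPolynomial.aeval t) (by
        rintro ⟨_, n, rfl⟩
        rw [map_pow]
        rw [hn]
        exact hz.pow n)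
    have hφ : ∀ k, φ (yRes R k) = t k := fun k => by
      simp only [φ, yRes, IsLocalization.liftAlgHom_apply, IsLocalization.lift_eq]
      exact MvPolynomial.aeval_X _ _
    refine ⟨φ, ?_, ?_⟩
    · change Algebra.TensorProduct.map φ _ _ = _
      rw [hm]
      exact congrArg _ (funext hφ)
    · intro ψ hψ
      rw [hm] at hψ
      have h := (ofTuple_bijective R T).1 hψ
      apply IsLocalization.algHom_ext (Submonoid.powers (resNorm R))
      apply MvPolynomial.algHom_ext
      intro k
      exact (congrFun h k).trans (hφ k).symm

/-- The coordinate ring `R[b, b⁻¹, x, x⁻¹]` of `𝔾_{m, L_b}`; the coordinates `b, x` have the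
indices `0, 1`. -/
abbrev OBX : Type u := Laurent R (Fin 2)

/-- The function `b x² - N_{S'/S}(y)` on `Res_{S'/S} 𝔾_{m,S'} × 𝔾_{m, L_b}`. -/
noncomputable def eqn : ORes R ⊗[R] OBX R :=
  1 ⊗ₜ (Laurent.x 0 * Laurent.x 1 ^ 2) - algebraMap _ (ORes R) (resNorm R) ⊗ₜ 1

/-- The coordinate ring of `𝓧`, the closed subscheme `b x² = N_{S'/S}(y)` of
`Res_{S'/S} 𝔾_{m,S'} × 𝔾_{m, L_b}` (product over `Spec R`). -/
def OX : Type u := (ORes R ⊗[R] OBX R) ⧸ Ideal.span {eqn R}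

noncomputable instance : CommRing (OX R) :=
  inferInstanceAs (CommRing ((ORes R ⊗[R] OBX R) ⧸ Ideal.span {eqn R}))

noncomputable instance : Algebra R (OX R) :=
  inferInstanceAs (Algebra R ((ORes R ⊗[R] OBX R) ⧸ Ideal.span {eqn R}))

/-- The quotient map onto the coordinate ring of `𝓧`. -/
noncomputable def mkX : ORes R ⊗[R] OBX R →ₐ[R] OX R := Ideal.Quotient.mkₐ R (Ideal.span {eqn R})

/-- The comorphism of `𝓧 → Res_{S'/S} 𝔾_{m,S'}`. -/
noncomputable def fromRes : ORes R →ₐ[R] OX R :=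
  (mkX R).comp Algebra.TensorProduct.includeLeft

/-- The comorphism of `𝓧 → 𝔾_{m, L_b}`. -/
noncomputable def fromBX : OBX R →ₐ[R] OX R :=
  (mkX R).comp Algebra.TensorProduct.includeRight

/-- The comorphism of `Res_{S'/S} 𝔾_{m,S'} → S`. -/
noncomputable def fromS : OS R →ₐ[R] ORes R :=
  (IsScalarTower.toAlgHom R (MvPolynomial (Fin 4) (OS R)) (ORes R)).comp
    (IsScalarTower.toAlgHom R (OS R) (MvPolynomial (Fin 4) (OS R)))

/-- The comorphism of the structure map `π : 𝓧 → L_a × L_b × L_c`. -/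
noncomputable def piX : Oabc R →ₐ[R] OX R :=
  Laurent.lift ![fromRes R (fromS R (Laurent.x 0)), fromBX R (Laurent.x 0),
    fromRes R (fromS R (Laurent.x 1))] (by
    intro i
    fin_cases i
    · exact ((Laurent.isUnit_x 0).map (fromS R)).map (fromRes R)
    · exact (Laurent.isUnit_x 0).map (fromBX R)
    · exact ((Laurent.isUnit_x 1).map (fromS R)).map (fromRes R))

/-! ### The map `𝔾_m⁴ × 𝓛 → 𝓧` -/

/-- The functions `u_k^*` on `𝔾_m⁴ × 𝓛`. -/
noncomputable def uP (k : ZMod 2 × ZMod 2) : OP R := Laurent.x k ⊗ₜ 1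

/-- The functions `α, β, γ` on `𝔾_m⁴ × 𝓛` (indices `0, 1, 2`). -/
noncomputable def lP (i : Fin 3) : OP R := 1 ⊗ₜ Laurent.x i

/-- The functions `α⁻¹, β⁻¹, γ⁻¹` on `𝔾_m⁴ × 𝓛` (indices `0, 1, 2`). -/
noncomputable def lPinv (i : Fin 3) : OP R := 1 ⊗ₜ Laurent.xinv i

/-- `d₁ = u₁^{*2} + u₂^{*2} + u₃^{*2} + u₄^{*2}`. -/
noncomputable def d1 : OP R := uP R (0, 0) ^ 2 + uP R (0, 1) ^ 2 + uP R (1, 0) ^ 2 + uP R (1, 1) ^ 2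

/-- `d₂ = u₁^{*2} + u₂^{*2} - u₃^{*2} - u₄^{*2}`. -/
noncomputable def d2 : OP R := uP R (0, 0) ^ 2 + uP R (0, 1) ^ 2 - uP R (1, 0) ^ 2 - uP R (1, 1) ^ 2

/-- `d₃ = u₁^{*2} - u₂^{*2} + u₃^{*2} - u₄^{*2}`. -/
noncomputable def d3 : OP R := uP R (0, 0) ^ 2 - uP R (0, 1) ^ 2 + uP R (1, 0) ^ 2 - uP R (1, 1) ^ 2

/-- `d₄ = u₁^{*2} - u₂^{*2} - u₃^{*2} + u₄^{*2}`. -/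
noncomputable def d4 : OP R := uP R (0, 0) ^ 2 - uP R (0, 1) ^ 2 - uP R (1, 0) ^ 2 + uP R (1, 1) ^ 2

lemma isUnit_uP (k : ZMod 2 × ZMod 2) : IsUnit (uP R k) :=
  (Laurent.isUnit_x k).map (Algebra.TensorProduct.includeLeft : OG R →ₐ[R] OP R)

lemma isUnit_lP (i : Fin 3) : IsUnit (lP R i) :=
  (Laurent.isUnit_x i).map (Algebra.TensorProduct.includeRight : OL R →ₐ[R] OP R)

lemma lP_mul_lPinv (i : Fin 3) : lP R i * lPinv R i = 1 := by
  rw [lP, lPinv, Algebra.TensorProduct.tmul_mul_tmul, Laurent.x_mul_xinv, one_mul]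
  rfl

lemma isUnit_lPinv (i : Fin 3) : IsUnit (lPinv R i) :=
  IsUnit.of_mul_eq_one_right _ (lP_mul_lPinv R i)

/-- The function `2⁴ u₁^* u₂^* u₃^* u₄^* / β`, the image of `x`. -/
noncomputable def xP : OP R :=
  2 ^ 4 * (uP R (0, 0) * uP R (0, 1) * uP R (1, 0) * uP R (1, 1)) * lPinv R 1

lemma isUnit_xP [Invertible (2 : R)] : IsUnit (xP R) := by
  have h2 : IsUnit (2 : OP R) := by
    have := (isUnit_of_invertible (2 : R)).map (algebraMap R (OP R))
    rwa [map_ofNat] at this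
  exact ((h2.pow 4).mul ((((isUnit_uP R _).mul (isUnit_uP R _)).mul (isUnit_uP R _)).mul
    (isUnit_uP R _))).mul (isUnit_lPinv R 1)

/-- `a ↦ α²`, `c ↦ γ²` and `y₁ ↦ d₁`, `y_α ↦ d₂ / α`, `y_γ ↦ d₃ / γ`, `y_{αγ} ↦ d₄ / (α γ)`. -/
noncomputable def polyToP : MvPolynomial (Fin 4) (OS R) →ₐ[R] OP R :=
  MvPolynomial.aevalTower
    (Laurent.lift ![lP R 0 ^ 2, lP R 2 ^ 2] (by
      intro i
      fin_cases i
      · exact (isUnit_lP R 0).pow 2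
      · exact (isUnit_lP R 2).pow 2))
    ![d1 R, d2 R * lPinv R 0, d3 R * lPinv R 2, d4 R * (lPinv R 0 * lPinv R 2)]

lemma polyToP_resNorm : polyToP R (resNorm R) = lP R 1 ^ 2 * xP R ^ 2 := by
  have e0 := lP_mul_lPinv R 0
  have e1 := lP_mul_lPinv R 1
  have e2 := lP_mul_lPinv R 2
  simp only [polyToP, resNorm, normPoly, map_sub, map_mul, map_pow, map_add, map_ofNat,
    MvPolynomial.aevalTower_C, MvPolynomial.aevalTower_X, Laurent.lift_x, xP]
  simp only [Matrix.cons_val_zero, Matrix.cons_val_one, Matrix.cons_val]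
  have h1 : lP R 0 ^ 2 * (d2 R * lPinv R 0) ^ 2 = d2 R ^ 2 := by
    linear_combination d2 R ^ 2 * (lP R 0 * lPinv R 0 + 1) * e0
  have h2 : lP R 2 ^ 2 * (d3 R * lPinv R 2) ^ 2 = d3 R ^ 2 := by
    linear_combination d3 R ^ 2 * (lP R 2 * lPinv R 2 + 1) * e2
  have h3 : lP R 0 ^ 2 * lP R 2 ^ 2 * (d4 R * (lPinv R 0 * lPinv R 2)) ^ 2 = d4 R ^ 2 := by
    calc _ = d4 R ^ 2 * (lP R 0 * lPinv R 0) ^ 2 * (lP R 2 * lPinv R 2) ^ 2 := by ring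
      _ = _ := by rw [e0, e2]; ring
  have h4 : lP R 2 ^ 2 * (2 * d1 R * (d3 R * lPinv R 2) -
      2 * lP R 0 ^ 2 * (d2 R * lPinv R 0) * (d4 R * (lPinv R 0 * lPinv R 2))) ^ 2 =
      (2 * d1 R * d3 R - 2 * d2 R * d4 R) ^ 2 := by
    calc _ = (2 * d1 R * d3 R * (lP R 2 * lPinv R 2) -
          2 * d2 R * d4 R * (lP R 0 * lPinv R 0) ^ 2 * (lP R 2 * lPinv R 2)) ^ 2 := by ring
      _ = _ := by rw [e0, e2]; ring
  have h5 : lP R 1 ^ 2 * (2 ^ 4 * (uP R (0, 0) * uP R (0, 1) * uP R (1, 0) * uP R (1, 1)) *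
      lPinv R 1) ^ 2 = (2 ^ 4 * (uP R (0, 0) * uP R (0, 1) * uP R (1, 0) * uP R (1, 1))) ^ 2 := by
    calc _ = (2 ^ 4 * (uP R (0, 0) * uP R (0, 1) * uP R (1, 0) * uP R (1, 1))) ^ 2 *
          (lP R 1 * lPinv R 1) ^ 2 := by ring
      _ = _ := by rw [e1]; ring
  rw [h1, h2, h3, h4, h5, d1, d2, d3, d4]
  ring

/-- The comorphism of `𝔾_m⁴ × 𝓛 → Res_{S'/S} 𝔾_{m,S'}`. -/
noncomputable def resToP [Invertible (2 : R)] : ORes R →ₐ[R] OP R :=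
  IsLocalization.liftAlgHom (M := Submonoid.powers (resNorm R)) (f := polyToP R) (by
    rintro ⟨_, n, rfl⟩
    rw [map_pow, polyToP_resNorm]
    exact (((isUnit_lP R 1).pow 2).mul ((isUnit_xP R).pow 2)).pow n)

/-- The comorphism `b ↦ β²`, `x ↦ 2⁴ u₁^* u₂^* u₃^* u₄^* / β` of
`𝔾_m⁴ × 𝓛 → 𝔾_{m, L_b}`. -/
noncomputable def bxToP [Invertible (2 : R)] : OBX R →ₐ[R] OP R :=
  Laurent.lift ![lP R 1 ^ 2, xP R] (by
    intro i
    fin_cases i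
    · exact (isUnit_lP R 1).pow 2
    · exact isUnit_xP R)

/-- The comorphism of the map `f : 𝔾_m⁴ × 𝓛 → 𝓧`. -/
noncomputable def torsorHom [Invertible (2 : R)] : OX R →ₐ[R] OP R :=
  Ideal.Quotient.liftₐ (R₁ := R) (Ideal.span {eqn R})
    (Algebra.TensorProduct.lift (resToP R) (bxToP R) (fun _ _ => Commute.all _ _)) (by
    intro z hz
    obtain ⟨w, rfl⟩ := Ideal.mem_span_singleton'.mp hz
    rw [map_mul]
    convert mul_zero _
    simp only [eqn, map_sub, Algebra.TensorProduct.lift_tmul, map_one, one_mul, mul_one, map_mul,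
      map_pow, bxToP, Laurent.lift_x, Matrix.cons_val_zero, Matrix.cons_val_one]
    rw [resToP, IsLocalization.liftAlgHom_apply, IsLocalization.lift_eq]
    exact sub_eq_zero.mpr (polyToP_resNorm R).symm)

lemma actP_uP [Invertible (2 : R)] (g : U4) (k : ZMod 2 × ZMod 2) :
    actP R g (uP R k) = sgn R (eps g⁻¹ (shift g⁻¹ k)) • uP R (shift g⁻¹ k) := by
  change Algebra.TensorProduct.map (actG R g) (actL R (q g)) (Laurent.x k ⊗ₜ 1) = _
  rw [Algebra.TensorProduct.map_tmul, map_one, uP, TensorProduct.smul_tmul', ← sum_repMatrix]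
  congr 1
  exact actG_x R g k

lemma actP_lP [Invertible (2 : R)] (g : U4) (i : Fin 3) :
    actP R g (lP R i) = sgn R (Multiplicative.toAdd (q g) i) • lP R i := by
  change Algebra.TensorProduct.map (actG R g) (actL R (q g)) (1 ⊗ₜ Laurent.x i) = _
  rw [Algebra.TensorProduct.map_tmul, map_one, lP, ← TensorProduct.tmul_smul]
  congr 1
  exact actL_x R (q g) i

lemma actP_lPinv [Invertible (2 : R)] (g : U4) (i : Fin 3) :
    actP R g (lPinv R i) = sgn R (Multiplicative.toAdd (q g) i) • lPinv R i := by
  have h1 := congrArg (actP R g) (lP_mul_lPinv R i)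
  rw [map_mul, map_one, actP_lP] at h1
  refine (isUnit_lP R i).mul_left_cancel ?_
  rw [mul_smul_comm, lP_mul_lPinv, ← h1, smul_mul_assoc, smul_smul, sgn_mul_self, one_smul]

lemma actP_uP_sq [Invertible (2 : R)] (g : U4) (k : ZMod 2 × ZMod 2) :
    actP R g (uP R k) ^ 2 = uP R (shift g⁻¹ k) ^ 2 := by
  rw [actP_uP, smul_pow, sq (sgn R _), sgn_mul_self, one_smul]

lemma inv_a01 (g : U4) : entry 0 1 g⁻¹ = entry 0 1 g := by
  have h := a01_mul g g⁻¹
  rw [mul_inv_cancel, show entry 0 1 1 = 0 from rfl] at h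
  exact (CharTwo.add_eq_zero.mp h.symm).symm

lemma inv_a12 (g : U4) : entry 1 2 g⁻¹ = entry 1 2 g := by
  have h := a12_mul g g⁻¹
  rw [mul_inv_cancel, show entry 1 2 1 = 0 from rfl] at h
  exact (CharTwo.add_eq_zero.mp h.symm).symm

lemma inv_a23 (g : U4) : entry 2 3 g⁻¹ = entry 2 3 g := by
  have h := a23_mul g g⁻¹
  rw [mul_inv_cancel, show entry 2 3 1 = 0 from rfl] at h
  exact (CharTwo.add_eq_zero.mp h.symm).symm

lemma sum_eps (h : U4) :
    eps h (0, 0) + eps h (0, 1) + eps h (1, 0) + eps h (1, 1) = entry 1 2 h := by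
  obtain ⟨b1, b2, -, b4, -, -⟩ := base_entries 0 0
  obtain ⟨c1, c2, -, c4, -, -⟩ := base_entries 1 0
  have p0 : posn (h * base 0 0) = entry 0 2 h + entry 0 1 h * entry 1 2 h := by
    simp only [posn, a01_mul, a02_mul, a12_mul, b1, b2, b4]; ring
  have p1 : posn (h * base 1 0) = entry 0 2 h + (entry 0 1 h + 1) * entry 1 2 h := by
    simp only [posn, a01_mul, a02_mul, a12_mul, c1, c2, c4]; ring
  have aux : ∀ S0 S1 P0 P1 r x y z : ZMod 2, P0 = x + y * z → P1 = x + (y + 1) * z →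
      (S0 + (r + 0) * P0) + (S0 + (r + 1) * P0) + (S1 + (r + 0) * P1) + (S1 + (r + 1) * P1)
        = z := by
    decide
  exact aux _ _ _ _ _ _ _ _ p0 p1

lemma actP_prod_uP [Invertible (2 : R)] (g : U4) :
    actP R g (uP R (0, 0) * uP R (0, 1) * uP R (1, 0) * uP R (1, 1)) =
      sgn R (entry 1 2 g) • (uP R (0, 0) * uP R (0, 1) * uP R (1, 0) * uP R (1, 1)) := by
  rw [← inv_a12, ← sum_eps]
  simp only [map_mul, actP_uP, smul_mul_smul_comm, ← sgn_add]
  have h0 : entry 0 1 g⁻¹ = 0 ∨ entry 0 1 g⁻¹ = 1 := by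
    generalize entry 0 1 g⁻¹ = z
    revert z; decide
  have h1 : entry 2 3 g⁻¹ = 0 ∨ entry 2 3 g⁻¹ = 1 := by
    generalize entry 2 3 g⁻¹ = z
    revert z; decide
  have e : (1 : ZMod 2) + 1 = 0 := rfl
  rcases h0 with h0 | h0 <;> rcases h1 with h1 | h1 <;>
    simp only [shift, h0, h1, add_zero, zero_add, e] <;>
    exact congrArg₂ (fun a b => sgn R a • b) (by abel) (by ring)

lemma actP_d [Invertible (2 : R)] (g : U4) :
    actP R g (d1 R) = d1 R ∧ actP R g (d2 R) = sgn R (entry 0 1 g) • d2 R ∧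
      actP R g (d3 R) = sgn R (entry 2 3 g) • d3 R ∧
      actP R g (d4 R) = sgn R (entry 0 1 g + entry 2 3 g) • d4 R := by
  rw [← inv_a01, ← inv_a23]
  simp only [d1, d2, d3, d4, map_add, map_sub, map_pow, actP_uP_sq, shift]
  have h0 : entry 0 1 g⁻¹ = 0 ∨ entry 0 1 g⁻¹ = 1 := by
    generalize entry 0 1 g⁻¹ = z
    revert z; decide
  have h1 : entry 2 3 g⁻¹ = 0 ∨ entry 2 3 g⁻¹ = 1 := by
    generalize entry 2 3 g⁻¹ = z
    revert z; decide
  have e : (1 : ZMod 2) + 1 = 0 := rfl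
  have s1 : ∀ z : OP R, sgn R 1 • z = -z := fun z => by
    have : sgn R 1 = -1 := by simp [sgn, ZMod.val_one]
    rw [this]
    exact neg_one_smul R z
  rcases h0 with h0 | h0 <;> rcases h1 with h1 | h1 <;>
    simp only [h0, h1, add_zero, zero_add, e, sgn_zero, s1, one_smul] <;>
    refine ⟨?_, ?_, ?_, ?_⟩ <;> first | trivial | ring

lemma actP_xP [Invertible (2 : R)] (g : U4) : actP R g (xP R) = xP R := by
  rw [xP, map_mul, map_mul, actP_prod_uP, actP_lPinv, map_pow, map_ofNat]
  change 2 ^ 4 * (sgn R (entry 1 2 g) • _) * (sgn R (entry 1 2 g) • _) = _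
  simp only [mul_smul_comm, smul_mul_assoc, smul_smul, sgn_mul_self, one_smul]

lemma actP_lP_sq [Invertible (2 : R)] (g : U4) (i : Fin 3) :
    actP R g (lP R i ^ 2) = lP R i ^ 2 := by
  rw [map_pow, actP_lP, smul_pow, sq (sgn R _), sgn_mul_self, one_smul]

lemma actP_polyToP [Invertible (2 : R)] (g : U4) (z : MvPolynomial (Fin 4) (OS R)) :
    actP R g (polyToP R z) = polyToP R z := by
  obtain ⟨e1, e2, e3, e4⟩ := actP_d R g
  have hC : ∀ w : OS R, actP R g (polyToP R (.C w)) = polyToP R (.C w) := by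
    intro w
    simp only [polyToP, MvPolynomial.aevalTower_C]
    rw [← AlgHom.comp_apply]
    refine DFunLike.congr_fun ?_ w
    apply Laurent.hom_ext
    intro i
    rw [AlgHom.comp_apply, Laurent.lift_x]
    fin_cases i
    · exact actP_lP_sq R g 0
    · exact actP_lP_sq R g 2
  induction z using MvPolynomial.induction_on with
  | C w => exact hC w
  | add p r hp hr => rw [map_add, map_add, hp, hr]
  | mul_X p i hp =>
    rw [map_mul, map_mul, hp]
    congr 1
    simp only [polyToP, MvPolynomial.aevalTower_X]
    fin_cases i
    · exact e1
    · change actP R g (d2 R * lPinv R 0) = d2 R * lPinv R 0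
      rw [map_mul, e2, actP_lPinv]
      change sgn R (entry 0 1 g) • _ * sgn R (entry 0 1 g) • _ = _
      rw [smul_mul_smul_comm, sgn_mul_self, one_smul]
    · change actP R g (d3 R * lPinv R 2) = d3 R * lPinv R 2
      rw [map_mul, e3, actP_lPinv]
      change sgn R (entry 2 3 g) • _ * sgn R (entry 2 3 g) • _ = _
      rw [smul_mul_smul_comm, sgn_mul_self, one_smul]
    · change actP R g (d4 R * (lPinv R 0 * lPinv R 2)) = d4 R * (lPinv R 0 * lPinv R 2)
      rw [map_mul, map_mul, e4, actP_lPinv, actP_lPinv]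
      change sgn R (entry 0 1 g + entry 2 3 g) • _ *
        (sgn R (entry 0 1 g) • _ * sgn R (entry 2 3 g) • _) = _
      rw [smul_mul_smul_comm, smul_mul_smul_comm, ← sgn_add, sgn_mul_self, one_smul]

lemma torsorHom_mk [Invertible (2 : R)] (z : ORes R ⊗[R] OBX R) :
    torsorHom R (mkX R z) =
      Algebra.TensorProduct.lift (resToP R) (bxToP R) (fun _ _ => Commute.all _ _) z :=
  rfl

/-- The map `f : 𝔾_m⁴ × 𝓛 → 𝓧` is `U₄`-invariant. -/
lemma torsorHom_invariant [Invertible (2 : R)] (g : U4) (z : OX R) :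
    actP R g (torsorHom R z) = torsorHom R z := by
  suffices hh : (actP R g).comp (torsorHom R) = torsorHom R from DFunLike.congr_fun hh z
  apply Ideal.Quotient.algHom_ext
  apply Algebra.TensorProduct.ext
  · apply IsLocalization.algHom_ext (Submonoid.powers (resNorm R))
    apply AlgHom.ext
    intro w
    have h : torsorHom R (mkX R
        (algebraMap (MvPolynomial (Fin 4) (OS R)) (ORes R) w ⊗ₜ[R] (1 : OBX R))) =
        polyToP R w := by
      rw [torsorHom_mk]
      rw [Algebra.TensorProduct.lift_tmul, map_one, mul_one, resToP,
        IsLocalization.liftAlgHom_apply, IsLocalization.lift_eq]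
      rfl
    change actP R g (torsorHom R (mkX R _)) =
      torsorHom R (mkX R _)
    erw [h]
    exact actP_polyToP R g w
  · apply Laurent.hom_ext
    intro i
    have h : torsorHom R (mkX R ((1 : ORes R) ⊗ₜ[R] (Laurent.x i : OBX R))) =
        ![lP R 1 ^ 2, xP R] i := by
      rw [torsorHom_mk]
      rw [Algebra.TensorProduct.lift_tmul, map_one, one_mul, bxToP, Laurent.lift_x]
    change actP R g (torsorHom R (mkX R _)) =
      torsorHom R (mkX R _)
    erw [h]
    fin_cases i
    · exact actP_lP_sq R g 1
    · exact actP_xP R g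

/-! ### The schemes and morphisms of the theorem -/

/-- The map `f : 𝔾_m⁴ × 𝓛 → 𝓧`. -/
noncomputable def torsorMap [Invertible (2 : R)] :
    Spec (CommRingCat.of (OP R)) ⟶ Spec (CommRingCat.of (OX R)) :=
  specMap (torsorHom R)

/-- The action of `U₄` on `𝔾_m⁴ × 𝓛`. -/
noncomputable def torsorAction [Invertible (2 : R)] :
    SchemeAction U4 (Spec (CommRingCat.of (OP R))) :=
  specAction (actP R)

/-- The map `𝓛 → L_a × L_b × L_c`. -/
noncomputable def kummerMap : Spec (CommRingCat.of (OL R)) ⟶ Spec (CommRingCat.of (Oabc R)) :=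
  specMap (kummer R)

/-- The action of `(ℤ/2)³` on `𝓛`. -/
noncomputable def kummerAction : SchemeAction K (Spec (CommRingCat.of (OL R))) :=
  specAction (actL R)

/-- The structure map `π : 𝓧 → L_a × L_b × L_c`. -/
noncomputable def structureMap : Spec (CommRingCat.of (OX R)) ⟶ Spec (CommRingCat.of (Oabc R)) :=
  specMap (piX R)

/-- The structure map `q_* (𝔾_m⁴ × 𝓛) → 𝓧` of the push-forward along `q`. -/
noncomputable def pushMap [Invertible (2 : R)] :
    Spec (CommRingCat.of (pushRing q (actP R))) ⟶ Spec (CommRingCat.of (OX R)) :=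
  specMap (pushStr q (actP R) (torsorHom R) (torsorHom_invariant R))

/-- The action of `(ℤ/2)³` on `q_* (𝔾_m⁴ × 𝓛)`. -/
noncomputable def pushForwardAction [Invertible (2 : R)] :
    SchemeAction K (Spec (CommRingCat.of (pushRing q (actP R)))) :=
  specAction (pushAction q (actP R))

/-- The structure map `π^* 𝓛 → 𝓧` of the pull-back of `𝓛` along `π`. -/
noncomputable def pullMap :
    pullback (structureMap R) (kummerMap R) ⟶ Spec (CommRingCat.of (OX R)) :=
  pullback.fst (structureMap R) (kummerMap R)

/-- The action of `(ℤ/2)³` on `π^* 𝓛`. -/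
noncomputable def pullBackAction :
    SchemeAction K (pullback (structureMap R) (kummerMap R)) :=
  pullbackAction (structureMap R) (kummerMap R) (kummerAction R)
    (specAction_invariant (actL R) (kummer R) (kummer_invariant R))

end

end MasseyTorsor

/-! Everything is affine, so the torsor statements become statements about Galois extensions of
rings in the sense of Chase–Harrison–Rosenberg: a finite group $G$ acts on $B$ with $A = B^G$, and
for each $g \neq 1$ some $g b - b$ is a unit. From such $b$ one builds a dual system $(x_i, y_i)$
with $\sum x_i\, g(y_i) = \delta_{g,1}$. Together with the trace, it shows that $B$ is finite
projective and étale over $A$, that $B \otimes_A B \cong \prod_G B$, and hence that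
$\operatorname{Spec} B \to \operatorname{Spec} A$ is a torsor (`IsGaloisHom.isTorsor`).

Both the Kummer cover and $f$ are towers of square roots. The extension given by $f$ adjoins to the
functions on $\mathcal X$ first $\alpha, \beta, \gamma$ and then $u_1^*, u_2^*, u_3^*$, because
$4u_k^{*2}$ is the $k$-th linear factor of $N_{S'/S}(y)$. The equation $b x^2 = N(y)$ makes $u_4^*$
superfluous: $2^4 u_1^*u_2^*u_3^*u_4^* = x\beta$. There are six square roots, and $|U_4| = 2^6$.
Injectivity holds because formal square roots of these six elements give an injective extension of
the functions on $\mathcal X$ that factors through $f$ (`exists_comp_torsorHom_eq`). Invariants are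
computed by descending the tower: at each stage an elementary matrix negates the last root and fixes
the earlier ones, and since $2$ is invertible an invariant lies one stage lower
(`mem_of_map_eq_self`). The unit condition comes from the signs on $\alpha, \beta, \gamma$ and, on
$\ker q$, from the signs on the $u_k^*$.

For the comparison, a $G$-equivariant map from a Galois extension $C/A_0$ to any $D$ with $D^G = A$,
lying over $A_0 \to A$, induces $A \otimes_{A_0} C \cong D$ (`IsGaloisHom.isPushout`). Applied to $C
= \mathcal O(\mathcal L)$ and $D = \mathcal O(q_*P)$, this is the isomorphism $q_*P \cong
\pi^*\mathcal L$. -/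

namespace MasseyTorsor

/-! ### Galois extensions of commutative rings -/

section Galois

variable {R : Type u} [CommRing R] {A B C D : Type u} [CommRing A] [CommRing B] [CommRing C]
  [CommRing D] [Algebra R A] [Algebra R B] [Algebra R C] [Algebra R D] {G : Type} [Group G]

/-- The homomorphism `f` identifies `A` with the ring of invariants `B^G`. -/
structure IsInvariantRing (f : A →ₐ[R] B) (ρ : G →* (B →ₐ[R] B)) : Prop where
  invariant : ∀ g a, ρ g (f a) = f a
  injective : Function.Injective f
  fixed : ∀ b, (∀ g, ρ g b = b) → ∃ a, f a = b

/-- The homomorphism `f` makes `B` a Galois extension of `A` with group `G`. -/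
structure IsGaloisHom (f : A →ₐ[R] B) (ρ : G →* (B →ₐ[R] B)) : Prop
    extends IsInvariantRing f ρ where
  separated : ∀ g, g ≠ 1 → ∃ b, IsUnit (ρ g b - b)

/-- The trace of an extension with `A = B^G`. -/
lemma IsInvariantRing.exists_trace [Fintype G] {f : A →ₐ[R] B} {ρ : G →* (B →ₐ[R] B)}
    (h : IsInvariantRing f ρ) : ∃ τ : B →+ A, ∀ b, f (τ b) = ∑ g, ρ g b := by
  have key : ∀ b, ∃ a, f a = ∑ g, ρ g b := fun b => h.fixed _ fun g => by
    rw [map_sum]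
    refine Fintype.sum_equiv (Equiv.mulLeft g) _ _ fun k => ?_
    rw [Equiv.coe_mulLeft, map_mul, AlgHom.mul_apply]
  choose τ hτ using key
  refine ⟨⟨⟨τ, h.injective ?_⟩, fun b c => h.injective ?_⟩, hτ⟩
  · simp [hτ]
  · change f (τ (b + c)) = f (τ b + τ c)
    simp [hτ, Finset.sum_add_distrib]

/-- A Galois extension has a dual system `(x_i, y_i)`: `∑ x_i g(y_i)` is `1` for `g = 1` and
`0` otherwise. -/
lemma IsGaloisHom.exists_dual [Fintype G] [DecidableEq G] {f : A →ₐ[R] B}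
    {ρ : G →* (B →ₐ[R] B)} (h : IsGaloisHom f ρ) :
    ∃ S : Finset (B × B), ∀ g, ∑ i ∈ S, i.1 * ρ g i.2 = if g = 1 then 1 else 0 := by
  let φ : G → (B ⊗[R] B →ₐ[R] B) := fun g =>
    Algebra.TensorProduct.lift (AlgHom.id R B) (ρ g) fun _ _ => Commute.all _ _
  have hφ : ∀ g b c, φ g (b ⊗ₜ c) = b * ρ g c := fun g b c => by simp [φ]
  -- With $v$ inverse to $gb - b$, take $z = v\,(gb \otimes 1 - 1 \otimes b)$: $\varphi_1$ sends it
  -- to $v(gb - b) = 1$ and $\varphi_g$ to $v(gb - gb) = 0$.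
  have hz : ∀ g : G, ∃ z : B ⊗[R] B, φ 1 z = 1 ∧ (g ≠ 1 → φ g z = 0) := fun g => by
    by_cases hg : g = 1
    · exact ⟨1, map_one _, fun h' => absurd hg h'⟩
    · obtain ⟨b, hb⟩ := h.separated g hg
      obtain ⟨v, hv⟩ := hb.exists_right_inv
      refine ⟨v ⊗ₜ 1 * (ρ g b ⊗ₜ 1 - 1 ⊗ₜ b), ?_, fun _ => ?_⟩
      · rw [map_mul, map_sub, hφ, hφ, hφ]
        simp only [map_one, AlgHom.one_apply, mul_one, one_mul]
        rw [mul_comm, hv]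
      · rw [map_mul, map_sub, hφ, hφ, hφ]
        simp
  choose z hz1 hz0 using hz
  -- The $\varphi_g$ are ring homomorphisms, so the product of the $z_g$ has value $1$ under
  -- $\varphi_1$ and $0$ under every other $\varphi_g$. Its pure tensors form the dual system.
  obtain ⟨S, hS⟩ := TensorProduct.exists_finset (∏ g, z g)
  refine ⟨S, fun g => ?_⟩
  have e : ∑ i ∈ S, i.1 * ρ g i.2 = φ g (∏ g, z g) := by
    rw [hS, map_sum]
    exact Finset.sum_congr rfl fun i _ => (hφ g _ _).symm
  rw [e, map_prod]
  split_ifs with hg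
  · subst hg
    exact Finset.prod_eq_one fun k _ => hz1 k
  · exact Finset.prod_eq_zero (Finset.mem_univ g) (hz0 g hg)

/-- Expanding the trace and exchanging the sums leaves $\sum_g \delta_{g,1}\, g(b)$. The
homomorphism $\psi$ allows a dual system of one ring to be used in another; with $\psi =
\mathrm{id}$ this is the usual expansion of $b$ by dual bases. -/
lemma sum_mul_trace [Fintype G] [DecidableEq G] {f : A →ₐ[R] B} {ρ : G →* (B →ₐ[R] B)}
    {τ : B →+ A} (hτ : ∀ b, f (τ b) = ∑ g, ρ g b) {S : Finset (D × D)} (ψ : D →ₐ[R] B)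
    (hS : ∀ g, ∑ i ∈ S, ψ i.1 * ρ g (ψ i.2) = if g = 1 then 1 else 0) (b : B) :
    ∑ i ∈ S, ψ i.1 * f (τ (ψ i.2 * b)) = b := by
  simp only [hτ, Finset.mul_sum, map_mul]
  rw [Finset.sum_comm]
  simp only [← mul_assoc, ← Finset.sum_mul, hS]
  simp

/-- Let `C` be a Galois extension of `A₀` with group `G`, and let `A = D^G`. A `G`-equivariant
homomorphism `C → D` over `A₀ → A` induces an isomorphism from `A ⊗_{A₀} C` to `D`. -/
lemma IsGaloisHom.isPushout [Finite G] {A₀ : Type u} [CommRing A₀] [Algebra R A₀]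
    {f₀ : A₀ →ₐ[R] C} {σ : G →* (C →ₐ[R] C)} (h₀ : IsGaloisHom f₀ σ)
    {f : A →ₐ[R] D} {ρ : G →* (D →ₐ[R] D)} (h : IsInvariantRing f ρ)
    (j : A₀ →ₐ[R] A) (ψ : C →ₐ[R] D) (hj : ∀ a, ψ (f₀ a) = f (j a))
    (hψ : ∀ g c, ψ (σ g c) = ρ g (ψ c)) :
    IsPushout (CommRingCat.ofHom j.toRingHom) (CommRingCat.ofHom f₀.toRingHom)
      (CommRingCat.ofHom f.toRingHom) (CommRingCat.ofHom ψ.toRingHom) := by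
  classical
  have := Fintype.ofFinite G
  obtain ⟨S, hS⟩ := h₀.exists_dual
  obtain ⟨τ₀, hτ₀⟩ := h₀.exists_trace
  obtain ⟨τ, hτ⟩ := h.exists_trace
  -- An equivariant homomorphism carries a dual system to a dual system, so no separation hypothesis
  -- on $D$ is needed.
  have hS' : ∀ g, ∑ i ∈ S, ψ i.1 * ρ g (ψ i.2) = if g = 1 then 1 else 0 := fun g => by
    have := congrArg ψ (hS g)
    rw [map_sum] at this
    simp only [map_mul, hψ] at this
    rw [this]
    split_ifs <;> simp
  have hττ : ∀ c, τ (ψ c) = j (τ₀ c) := fun c => h.injective (by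
    rw [hτ, ← hj, hτ₀, map_sum]
    exact Finset.sum_congr rfl fun g _ => (hψ g c).symm)
  have hτf : ∀ a d, τ (f a * d) = a * τ d := fun a d => h.injective (by
    rw [hτ, map_mul, hτ, Finset.mul_sum]
    exact Finset.sum_congr rfl fun g _ => by rw [map_mul, h.invariant])
  algebraize [j.toRingHom, f₀.toRingHom, f.toRingHom, ψ.toRingHom]
  let : Algebra A₀ D := (f.toRingHom.comp j.toRingHom).toAlgebra
  have : IsScalarTower A₀ A D := IsScalarTower.of_algebraMap_eq fun _ => rfl
  have : IsScalarTower A₀ C D := IsScalarTower.of_algebraMap_eq fun a => (hj a).symm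
  let m : A ⊗[A₀] C →ₐ[A₀] D := Algebra.TensorProduct.productMap
    (IsScalarTower.toAlgHom A₀ A D) (IsScalarTower.toAlgHom A₀ C D)
  have hm : ∀ a c, m (a ⊗ₜ c) = f a * ψ c := fun a c => rfl
  -- The inverse of $m$ is $d \mapsto \sum \tau(\psi(y_i)\, d) \otimes x_i$. On $a \otimes c$ the
  -- trace equals $a\, j(\tau_0(y_i c))$; moving $\tau_0(y_i c)$ across the tensor sign leaves the
  -- dual basis expansion of $c$.
  have hz : ∀ z : A ⊗[A₀] C, ∑ i ∈ S, τ (ψ i.2 * m z) ⊗ₜ[A₀] i.1 = z := by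
    intro z
    induction z using TensorProduct.induction_on with
    | zero => simp
    | add y z hy hz =>
      simp only [map_add, mul_add, TensorProduct.add_tmul, Finset.sum_add_distrib, hy, hz]
    | tmul a c =>
      have hc := sum_mul_trace hτ₀ (AlgHom.id R C) hS c
      conv_rhs => rw [← hc, TensorProduct.tmul_sum]
      refine Finset.sum_congr rfl fun i _ => ?_
      rw [hm, mul_left_comm, hτf, ← map_mul, hττ]
      have e1 : a * j (τ₀ (i.2 * c)) = τ₀ (i.2 * c) • a := by
        rw [Algebra.smul_def, mul_comm]; rfl
      have e2 : (AlgHom.id R C) i.1 * f₀ (τ₀ ((AlgHom.id R C) i.2 * c)) =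
          τ₀ (i.2 * c) • i.1 := by
        rw [Algebra.smul_def, mul_comm]; rfl
      rw [e1, e2, TensorProduct.smul_tmul]
  have hbij : Function.Bijective m := by
    refine ⟨fun y z hyz => by rw [← hz y, ← hz z, hyz], fun d => ?_⟩
    refine ⟨∑ i ∈ S, τ (ψ i.2 * d) ⊗ₜ[A₀] i.1, ?_⟩
    rw [map_sum, ← sum_mul_trace hτ ψ hS' d]
    refine Finset.sum_congr rfl fun i _ => ?_
    rw [hm, mul_comm, sum_mul_trace hτ ψ hS' d]
  have hp := CommRingCat.isPushout_tensorProduct A₀ A C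
  let e : CommRingCat.of (A ⊗[A₀] C) ≅ CommRingCat.of D :=
    (RingEquiv.ofBijective m.toRingHom hbij).toCommRingCatIso
  refine IsPushout.of_iso hp (Iso.refl _) (Iso.refl _) (Iso.refl _) e ?_ ?_ ?_ ?_
  · rfl
  · rfl
  · ext a
    change m (a ⊗ₜ 1) = f a
    rw [hm, map_one, mul_one]
  · ext c
    change m (1 ⊗ₜ c) = ψ c
    rw [hm, map_one, one_mul]

/-- The translation action of `G` on families `G → B`, and `B` as its ring of invariants. -/
def translationAction (R : Type u) [CommRing R] (B : Type u) [CommRing B] [Algebra R B]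
    (G : Type) [Group G] : G →* ((G → B) →ₐ[R] (G → B)) where
  toFun k := AlgHom.pi fun g => Pi.evalAlgHom R (fun _ : G => B) (g * k)
  map_one' := by ext φ g; simp
  map_mul' k l := by ext φ g; simp [mul_assoc]

/-- The homomorphism `B → ∏_G B` onto the constant families. -/
def constHom (R : Type u) [CommRing R] (B : Type u) [CommRing B] [Algebra R B] (G : Type) :
    B →ₐ[R] (G → B) :=
  AlgHom.pi fun _ => AlgHom.id R B

/-- $G$ is transitive on itself, so an invariant family is determined by its value at $1$. This is
the trivial torsor, to which the pushout criterion compares $B \otimes_A B$. -/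
lemma isInvariantRing_constHom : IsInvariantRing (constHom R B G) (translationAction R B G) where
  invariant _ _ := rfl
  injective _ _ h := congrFun h 1
  fixed φ h := ⟨φ 1, funext fun g => by
    have := congrFun (h g) 1
    exact this.symm.trans (congrArg φ (one_mul g))⟩

/-- `B ⊗_A B` is `∏_G B` for a Galois extension. -/
lemma IsGaloisHom.isPushout_pi [Finite G] {f : A →ₐ[R] B} {ρ : G →* (B →ₐ[R] B)}
    (h : IsGaloisHom f ρ) :
    IsPushout (CommRingCat.ofHom f.toRingHom) (CommRingCat.ofHom f.toRingHom)
      (CommRingCat.ofHom (constHom R B G).toRingHom)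
      (CommRingCat.ofHom (AlgHom.pi fun g : G => ρ g).toRingHom) :=
  h.isPushout isInvariantRing_constHom f (AlgHom.pi fun g : G => ρ g)
    (fun a => funext fun g => h.invariant g a)
    (fun k b => funext fun g => (DFunLike.congr_fun (map_mul ρ g k) b).symm)

/-- The dual basis expansion splits a surjection from a finite free module, so $B$ is finite
projective over $A$, hence flat, finitely presented and integral. Unramifiedness follows from the
separability idempotent $\sum x_i \otimes y_i$. -/
lemma IsGaloisHom.etale [Finite G] {f : A →ₐ[R] B} {ρ : G →* (B →ₐ[R] B)}
    (h : IsGaloisHom f ρ) : f.toRingHom.Etale ∧ f.toRingHom.IsIntegral := by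
  classical
  have := Fintype.ofFinite G
  obtain ⟨S, hS⟩ := h.exists_dual
  obtain ⟨τ, hτ⟩ := h.exists_trace
  have hb := sum_mul_trace hτ (AlgHom.id R B) hS
  have hτf : ∀ a d, τ (f a * d) = a * τ d := fun a d => h.injective (by
    rw [hτ, map_mul, hτ, Finset.mul_sum]
    exact Finset.sum_congr rfl fun g _ => by rw [map_mul, h.invariant])
  algebraize [f.toRingHom]
  have hsm : ∀ (a : A) (b : B), a • b = f a * b := fun a b => Algebra.smul_def a b
  let s : B →ₗ[A] (S → A) :=
    { toFun := fun b i => τ (i.1.2 * b)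
      map_add' := fun b c => funext fun i => by simp [mul_add]
      map_smul' := fun a b => funext fun i => by
        rw [hsm, mul_left_comm, hτf]; rfl }
  let p : (S → A) →ₗ[A] B := Fintype.linearCombination A fun i => i.1.1
  have hps : p ∘ₗ s = LinearMap.id := LinearMap.ext fun b => by
    conv_rhs => rw [LinearMap.id_apply, ← hb b, ← Finset.sum_coe_sort]
    rw [LinearMap.comp_apply, Fintype.linearCombination_apply]
    refine Finset.sum_congr rfl fun i _ => ?_
    rw [hsm, mul_comm]
    rfl
  have hproj : Module.Projective A B := Module.Projective.of_split s p hps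
  have hfin : Module.Finite A B :=
    Module.Finite.of_surjective p fun b => ⟨s b, LinearMap.congr_fun hps b⟩
  have hfp : Module.FinitePresentation A B := Module.finitePresentation_of_projective A B
  have hafp : Algebra.FinitePresentation A B := inferInstance
  have hunr : Algebra.FormallyUnramified A B := by
    rw [Algebra.FormallyUnramified.iff_exists_tensorProduct]
    let φ : G → (B ⊗[A] B →ₐ[A] B) := fun g => Algebra.TensorProduct.lift (AlgHom.id A B)
      (⟨ρ g, h.invariant g⟩ : B →ₐ[A] B) fun _ _ => Commute.all _ _
    have hφ : ∀ g b c, φ g (b ⊗ₜ c) = b * ρ g c := fun g b c => rfl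
    -- This recovers $z \in B \otimes_A B$ from the family $(\varphi_g z)_g$, so identities in $B
    -- \otimes_A B$ may be checked after applying every $\varphi_g$.
    have hz : ∀ z, ∑ i ∈ S, (∑ g, ρ g i.2 * φ g z) ⊗ₜ[A] i.1 = z := by
      intro z
      induction z using TensorProduct.induction_on with
      | zero => simp
      | add y z hy hz =>
        simp only [map_add, mul_add, TensorProduct.add_tmul, Finset.sum_add_distrib, hy, hz]
      | tmul b c =>
        conv_rhs => rw [← hb c, TensorProduct.tmul_sum]
        refine Finset.sum_congr rfl fun i _ => ?_
        have e : ∑ g, ρ g i.2 * φ g (b ⊗ₜ c) = τ (i.2 * c) • b := by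
          rw [hsm, hτ, Finset.sum_mul]
          refine Finset.sum_congr rfl fun g _ => ?_
          rw [hφ, map_mul]
          ring
        rw [e, TensorProduct.smul_tmul, hsm, mul_comm]
        rfl
    have hinj : ∀ z, (∀ g, φ g z = 0) → z = 0 := fun z h0 => by
      rw [← hz z]
      simp [h0]
    -- $\varphi_g$ of this element is $\delta_{g,1}$, while $\varphi_g(1 \otimes b - b \otimes 1) =
    -- gb - b$ vanishes for $g = 1$; hence every $\varphi_g$ kills the product.
    refine ⟨∑ i ∈ S, i.1 ⊗ₜ i.2, fun b => hinj _ fun g => ?_, ?_⟩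
    · have e := hS g
      rw [map_mul, map_sub, map_sum]
      simp only [hφ, map_one, one_mul, mul_one]
      rw [e]
      split_ifs with hg
      · subst hg; simp
      · simp
    · have e := hS 1
      rw [map_sum]
      simpa using e
  have : Algebra.Etale A B := Algebra.Etale.of_formallyUnramified_of_flat
  exact ⟨this, algebraMap_isIntegral_iff.mpr inferInstance⟩

end Galois

/-! ### Torsors of affine schemes -/

section Torsor

variable {R : Type u} [CommRing R] {A B : Type u} [CommRing A] [CommRing B]
  [Algebra R A] [Algebra R B] {G : Type} [Group G]

/-- The canonical isomorphism `∐_{i ∈ ULift G} Spec B ⟶ Spec (∏_G B)`. -/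
lemma isIso_sigmaDesc_evalRingHom (B : Type u) [CommRing B] (G : Type) [Finite G] :
    IsIso (Sigma.desc fun i : ULift.{u} G =>
      Spec.map (CommRingCat.ofHom (Pi.evalRingHom (fun _ : G => B) i.down))) := by
  let e : (G → B) ≃+* (ULift.{u} G → B) :=
    RingEquiv.piCongrLeft (fun _ => B) Equiv.ulift.symm
  have h : (Sigma.desc fun i : ULift.{u} G =>
      Spec.map (CommRingCat.ofHom (Pi.evalRingHom (fun _ : G => B) i.down))) =
      sigmaSpec (fun _ : ULift.{u} G => CommRingCat.of B) ≫
        Spec.map e.toCommRingCatIso.hom := by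
    apply Sigma.hom_ext
    intro i
    rw [Sigma.ι_desc, ι_sigmaSpec_assoc, ← Spec.map_comp]
    rfl
  rw [h]
  infer_instance

/-- A Galois extension of rings is a torsor. -/
lemma IsGaloisHom.isTorsor [Finite G] {f : A →ₐ[R] B} {ρ : G →* (B →ₐ[R] B)}
    (h : IsGaloisHom f ρ) : IsTorsor (specMap f) (specAction ρ) where
  invariant := specAction_invariant ρ f h.invariant
  etale := (HasRingHomProperty.Spec_iff (P := @Etale)).mpr h.etale.1
  -- Lying over for an injective integral homomorphism.
  surjective := by
    refine ⟨?_⟩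
    exact RingHom.IsIntegral.comap_surjective h.etale.2 h.injective
  isIso_shear := by
    -- The square is flipped because the shear map $(gp, p)$ has the action as its first component.
    have hp : IsPullback _ _ (specMap f) (specMap f) :=
      (isPullback_SpecMap_of_isPushout _ _ _ _ h.isPushout_pi).flip
    have := isIso_sigmaDesc_evalRingHom B G
    -- Inversion enters because $g$ acts on points through $\rho(g^{-1})$ on functions, while the
    -- component of $B \otimes_A B \cong \prod_G B$ at $g$ uses $\rho(g)$.
    let ε : ULift.{u} G ≃ G := Equiv.ulift.trans (Equiv.inv G)
    have key : (Sigma.reindex ε fun _ : G => Spec (CommRingCat.of B)).hom ≫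
        (Sigma.desc fun g : G => pullback.lift (f := specMap f) (g := specMap f)
          ((specAction ρ).act g) (𝟙 _)
          (by simp [specAction_invariant ρ f h.invariant])) =
        (Sigma.desc fun i : ULift.{u} G =>
          Spec.map (CommRingCat.ofHom (Pi.evalRingHom (fun _ : G => B) i.down))) ≫
        hp.isoPullback.hom := by
      apply Sigma.hom_ext
      intro i
      rw [Sigma.ι_reindex_hom_assoc, Sigma.ι_desc, Sigma.ι_desc_assoc]
      apply pullback.hom_ext
      · rw [pullback.lift_fst, Category.assoc, hp.isoPullback_hom_fst, ← Spec.map_comp]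
        change Spec.map (CommRingCat.ofHom (ρ (i.down⁻¹)⁻¹).toRingHom) = _
        rw [inv_inv]
        rfl
      · rw [pullback.lift_snd, Category.assoc, hp.isoPullback_hom_snd, ← Spec.map_comp]
        exact (Spec.map_id _).symm
    rw [← isIso_comp_left_iff (Sigma.reindex ε fun _ : G => Spec (CommRingCat.of B)).hom]
    erw [key]
    infer_instance

/-- A scheme with action that is isomorphic to a torsor is a torsor. -/
lemma IsTorsor.of_torsorIso {P Q X : Scheme.{u}} {f : P ⟶ X} {ρ : SchemeAction G P}
    {f' : Q ⟶ X} {ρ' : SchemeAction G Q} (h : IsTorsor f ρ) (e : TorsorIso f ρ f' ρ') :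
    IsTorsor f' ρ' := by
  obtain ⟨e, he, hρ⟩ := e
  have hf' : f' = e.inv ≫ f := by rw [← he, e.inv_hom_id_assoc]
  have hρ' : ∀ g, ρ'.act g = e.inv ≫ ρ.act g ≫ e.hom := fun g => by
    rw [hρ, e.inv_hom_id_assoc]
  have hinv : ∀ g, ρ'.act g ≫ f' = f' := fun g => by
    rw [hρ', hf', Category.assoc, Category.assoc, e.hom_inv_id_assoc, h.invariant]
  have := h.etale
  have := h.surjective
  have := h.isIso_shear
  refine ⟨hinv, hf' ▸ inferInstance, hf' ▸ inferInstance, ?_⟩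
  have hg : ∀ g, e.hom ≫ pullback.lift (f := f') (g := f') (ρ'.act g) (𝟙 Q) (by simp [hinv g]) =
      pullback.lift (f := f) (g := f) (ρ.act g) (𝟙 P) (by simp [h.invariant g]) ≫
        pullback.map f f f' f' e.hom e.hom (𝟙 X) (by simp [he]) (by simp [he]) := by
    intro g
    apply pullback.hom_ext
    · rw [Category.assoc, pullback.lift_fst, Category.assoc, pullback.lift_fst,
        pullback.lift_fst_assoc, hρ]
    · rw [Category.assoc, pullback.lift_snd, Category.assoc, pullback.lift_snd,
        pullback.lift_snd_assoc, Category.comp_id, Category.id_comp]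
  -- The two shear maps are conjugate under the isomorphisms induced by $e$ on the coproducts and on
  -- the fibre products.
  have key : (Sigma.mapIso fun _ : G => e).hom ≫
      (Sigma.desc fun g : G => pullback.lift (f := f') (g := f') (ρ'.act g) (𝟙 Q)
        (by simp [hinv g])) =
      (Sigma.desc fun g : G => pullback.lift (f := f) (g := f) (ρ.act g) (𝟙 P)
        (by simp [h.invariant g])) ≫
      pullback.map f f f' f' e.hom e.hom (𝟙 X) (by simp [he]) (by simp [he]) := by
    apply Sigma.hom_ext
    intro g
    rw [Sigma.ι_desc_assoc, ← hg g]
    simp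
  rw [← isIso_comp_left_iff (Sigma.mapIso fun _ : G => e).hom, key]
  infer_instance

end Torsor

/-! ### Adjoining square roots -/

section SquareRoots

variable {R : Type u} [CommRing R] {B : Type u} [CommRing B] [Algebra R B]

/-- Every element has a square root in some extension ring. -/
lemma exists_injective_sq_eq (a : B) : ∃ (T : Type u) (_ : CommRing T) (_ : Algebra R T)
    (φ : B →ₐ[R] T) (t : T), Function.Injective φ ∧ t ^ 2 = φ a := by
  let p : Polynomial B := Polynomial.X ^ 2 - Polynomial.C a
  have hp : p.Monic := Polynomial.monic_X_pow_sub_C a two_ne_zero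
  refine ⟨AdjoinRoot p, inferInstance, inferInstance,
    { AdjoinRoot.of p with commutes' := fun r => rfl }, AdjoinRoot.root p, ?_, ?_⟩
  · refine (injective_iff_map_eq_zero (AdjoinRoot.of p)).mpr fun b hb => ?_
    nontriviality B
    by_contra hb0
    -- A nonzero constant has degree below $2$, so the monic polynomial $X^2 - a$ cannot divide it.
    refine hp.not_dvd_of_degree_lt (q := Polynomial.C b) (by simpa using hb0) ?_
      (AdjoinRoot.mk_eq_zero.mp hb)
    rw [Polynomial.degree_X_pow_sub_C two_pos]
    exact Polynomial.degree_C_le.trans_lt (by norm_num)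
  · have h : AdjoinRoot.mk p p = 0 := AdjoinRoot.mk_self
    rw [map_sub, map_pow, AdjoinRoot.mk_X, AdjoinRoot.mk_C, sub_eq_zero] at h
    exact h

/-- Since $t^2 \in S$, the set $S + St$ is closed under multiplication. -/
lemma exists_eq_add_mul_of_mem_sup_adjoin (S : Subalgebra R B) {t : B} (ht : t ^ 2 ∈ S) {b : B}
    (hb : b ∈ S ⊔ Algebra.adjoin R {t}) : ∃ s ∈ S, ∃ s' ∈ S, b = s + s' * t := by
  let S' : Subalgebra R B :=
    { carrier := {b | ∃ s ∈ S, ∃ s' ∈ S, b = s + s' * t}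
      mul_mem' := by
        rintro _ _ ⟨p, hp, p', hp', rfl⟩ ⟨r, hr, r', hr', rfl⟩
        exact ⟨p * r + p' * r' * t ^ 2,
          add_mem (mul_mem hp hr) (mul_mem (mul_mem hp' hr') ht),
          p * r' + p' * r, add_mem (mul_mem hp hr') (mul_mem hp' hr), by ring⟩
      add_mem' := by
        rintro _ _ ⟨p, hp, p', hp', rfl⟩ ⟨r, hr, r', hr', rfl⟩
        exact ⟨p + r, add_mem hp hr, p' + r', add_mem hp' hr', by ring⟩
      algebraMap_mem' := fun r => ⟨_, S.algebraMap_mem r, 0, zero_mem _, by simp⟩ }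
  have hS : S ⊔ Algebra.adjoin R {t} ≤ S' := by
    refine sup_le (fun s hs => ⟨s, hs, 0, zero_mem _, by simp⟩) ?_
    rw [Algebra.adjoin_le_iff, Set.singleton_subset_iff]
    exact ⟨0, zero_mem _, 1, one_mem _, by simp⟩
  exact hS hb

/-- If `t² ∈ S` and `g` fixes `S` and maps `t` to `-t`, the invariants of `g` in `S[t]` lie
in `S`. -/
lemma mem_of_map_eq_self [Invertible (2 : R)] (S : Subalgebra R B) {t : B} (ht : t ^ 2 ∈ S)
    (g : B →ₐ[R] B) (hS : S ≤ AlgHom.equalizer g (AlgHom.id R B)) (hg : g t = -t) {b : B}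
    (hb : b ∈ S ⊔ Algebra.adjoin R {t}) (hgb : g b = b) : b ∈ S := by
  obtain ⟨s, hs, s', hs', rfl⟩ := exists_eq_add_mul_of_mem_sup_adjoin S ht hb
  have e1 : g s = s := hS hs
  have e2 : g s' = s' := hS hs'
  rw [map_add, map_mul, e1, e2, hg] at hgb
  -- Comparing $s - s't$ with $s + s't$. Uniqueness of $s, s'$, that is, freeness of $S[t]$ over
  -- $S$, plays no role.
  have e3 : (2 : R) • (s' * t) = 0 := by
    rw [two_smul]
    linear_combination -hgb
  have e4 : s' * t = 0 := by
    rw [← one_smul R (s' * t), ← invOf_mul_self (2 : R), mul_smul, e3, smul_zero]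
  rwa [e4, add_zero]

lemma adjoin_singleton_le_equalizer {g : B →ₐ[R] B} {t : B} (h : g t = t) :
    Algebra.adjoin R {t} ≤ AlgHom.equalizer g (AlgHom.id R B) := by
  rw [Algebra.adjoin_le_iff, Set.singleton_subset_iff]
  exact h

lemma isUnit_two_pow [Invertible (2 : R)] (n : ℕ) : IsUnit (2 ^ n : B) := by
  have := (isUnit_of_invertible (2 : R)).map (algebraMap R B)
  rw [map_ofNat] at this
  exact this.pow n

lemma isUnit_neg_sub_self [Invertible (2 : R)] {t : B} (ht : IsUnit t) : IsUnit (-t - t) := by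
  have := ((isUnit_two_pow (R := R) (B := B) 1).mul ht).neg
  convert this using 1
  ring

lemma mem_of_two_pow_mul_mem [Invertible (2 : R)] (S : Subalgebra R B) (n : ℕ) {t : B}
    (h : 2 ^ n * t ∈ S) : t ∈ S := by
  have h1 := S.smul_mem h ((⅟2 : R) ^ n)
  have e : ((⅟2 : R) ^ n) • (2 ^ n * t) = t := by
    have : (2 ^ n * t : B) = ((2 : R) ^ n) • t := by
      rw [Algebra.smul_def, map_pow, map_ofNat]
    rw [this, smul_smul, ← mul_pow, invOf_mul_self, one_pow, one_smul]
  rwa [e] at h1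

/-- Used to see that the top of a tower of square roots is the whole ring. -/
lemma Laurent.eq_top_of_mem {σ : Type} [Fintype σ] (S : Subalgebra R (Laurent R σ))
    (hx : ∀ i, Laurent.x i ∈ S) (hinv : ∀ i, Laurent.xinv i ∈ S) : S = ⊤ := by
  rw [eq_top_iff]
  intro z _
  have hpoly : ∀ p : MvPolynomial σ R, algebraMap _ (Laurent R σ) p ∈ S := by
    intro p
    induction p using MvPolynomial.induction_on with
    | C r =>
      have : algebraMap _ (Laurent R σ) (MvPolynomial.C r : MvPolynomial σ R) =
          algebraMap R (Laurent R σ) r :=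
        (IsScalarTower.algebraMap_apply R (MvPolynomial σ R) (Laurent R σ) r).symm
      rw [this]
      exact S.algebraMap_mem r
    | add p r hp hr => rw [map_add]; exact add_mem hp hr
    | mul_X p i hp => rw [map_mul]; exact mul_mem hp (hx i)
  obtain ⟨⟨p, ⟨_, n, rfl⟩⟩, h⟩ := IsLocalization.surj
    (Submonoid.powers (∏ i, MvPolynomial.X i : MvPolynomial σ R)) z
  have e : z = algebraMap _ (Laurent R σ) p * (∏ i, Laurent.xinv i) ^ n := by
    rw [← h, map_pow, map_prod, mul_assoc, ← mul_pow, ← Finset.prod_mul_distrib]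
    have e1 : ∏ i, algebraMap (MvPolynomial σ R) (Laurent R σ) (MvPolynomial.X i) *
        Laurent.xinv i = 1 := Finset.prod_eq_one fun i _ => Laurent.x_mul_xinv i
    rw [e1, one_pow, mul_one]
  rw [e]
  exact mul_mem (hpoly p) (pow_mem (prod_mem fun i _ => hinv i) n)

lemma sgn_one : sgn R 1 = -1 := by simp [sgn, ZMod.val_one]

lemma zmod_two_eq_one {z : ZMod 2} (h : z ≠ 0) : z = 1 := by
  revert z; decide

end SquareRoots

/-! ### The Kummer torsor -/

section Kummer

variable (R : Type u) [CommRing R]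

/-- Formal square roots of $a, b, c$ exist in an injective extension of $R[a^{\pm1}, b^{\pm1},
c^{\pm1}]$. Sending $\alpha, \beta, \gamma$ to them factors this injection through the Kummer map,
which is therefore injective. -/
lemma kummer_injective : Function.Injective (kummer R) := by
  obtain ⟨T₁, _, _, φ₁, t₁, h₁, e₁⟩ :=
    exists_injective_sq_eq (R := R) (Laurent.x 0 : Oabc R)
  obtain ⟨T₂, _, _, φ₂, t₂, h₂, e₂⟩ := exists_injective_sq_eq (R := R) (φ₁ (Laurent.x 1))
  obtain ⟨T₃, _, _, φ₃, t₃, h₃, e₃⟩ :=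
    exists_injective_sq_eq (R := R) (φ₂ (φ₁ (Laurent.x 2)))
  let φ : Oabc R →ₐ[R] T₃ := (φ₃.comp φ₂).comp φ₁
  let t : Fin 3 → T₃ := ![φ₃ (φ₂ t₁), φ₃ t₂, t₃]
  have ht : ∀ i, t i ^ 2 = φ (Laurent.x i) := by
    intro i
    fin_cases i
    · change φ₃ (φ₂ t₁) ^ 2 = _
      rw [← map_pow, ← map_pow, e₁]; rfl
    · change φ₃ t₂ ^ 2 = _
      rw [← map_pow, e₂]; rfl
    · exact e₃
  have hu : ∀ i, IsUnit (t i) := fun i => by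
    rw [← isUnit_pow_iff two_ne_zero, ht]
    exact (Laurent.isUnit_x i).map φ
  have h : (Laurent.lift t hu : OL R →ₐ[R] T₃).comp (kummer R) = φ := by
    apply Laurent.hom_ext
    intro i
    rw [AlgHom.comp_apply, kummer, Laurent.lift_x, map_pow, Laurent.lift_x, ht]
  have hφ : Function.Injective φ := h₃.comp (h₂.comp h₁)
  rw [← h] at hφ
  rw [AlgHom.coe_comp] at hφ
  exact hφ.of_comp

/-- A nontrivial sign change moves some coordinate $t$ by $-2t$, a unit. For the invariants, the
roots are adjoined one at a time, and the $i$-th generator of $(\mathbb Z/2)^3$ negates only the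
$i$-th root. -/
lemma kummer_isGaloisHom [Invertible (2 : R)] : IsGaloisHom (kummer R) (actL R) where
  invariant := kummer_invariant R
  injective := kummer_injective R
  separated h hh := by
    obtain ⟨i, hi⟩ : ∃ i, Multiplicative.toAdd h i ≠ 0 := by
      by_contra! h0
      exact hh (Multiplicative.toAdd.injective (funext h0))
    refine ⟨Laurent.x i, ?_⟩
    rw [actL_x, zmod_two_eq_one hi, sgn_one, neg_one_smul]
    exact isUnit_neg_sub_self (R := R) (Laurent.isUnit_x i)
  fixed b hb := by
    have hsq : ∀ i, (Laurent.x i : OL R) ^ 2 ∈ (kummer R).range := fun i =>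
      ⟨Laurent.x i, Laurent.lift_x _ _ i⟩
    have hact : ∀ i j, actL R (Multiplicative.ofAdd (Pi.single i 1)) (Laurent.x j) =
        if i = j then -Laurent.x j else Laurent.x j := fun i j => by
      rw [actL_x, toAdd_ofAdd]
      split_ifs with h
      · rw [h, Pi.single_eq_same, sgn_one, neg_one_smul]
      · rw [Pi.single_eq_of_ne (Ne.symm h), sgn_zero, one_smul]
    have h0 : ∀ h, (kummer R).range ≤ AlgHom.equalizer (actL R h) (AlgHom.id R (OL R)) := by
      rintro h _ ⟨z, rfl⟩
      exact kummer_invariant R h z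
    have hfix : ∀ i j, i ≠ j → Algebra.adjoin R {(Laurent.x j : OL R)} ≤
        AlgHom.equalizer (actL R (Multiplicative.ofAdd (Pi.single i 1))) (AlgHom.id R (OL R)) :=
      fun i j hij => adjoin_singleton_le_equalizer (by rw [hact, if_neg hij])
    have hneg : ∀ i, actL R (Multiplicative.ofAdd (Pi.single i 1)) (Laurent.x i) =
        -Laurent.x i := fun i => by rw [hact, if_pos rfl]
    set S₁ := (kummer R).range ⊔ Algebra.adjoin R {(Laurent.x 0 : OL R)}
    set S₂ := S₁ ⊔ Algebra.adjoin R {(Laurent.x 1 : OL R)}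
    set S₃ := S₂ ⊔ Algebra.adjoin R {(Laurent.x 2 : OL R)}
    have l₁ : (kummer R).range ≤ S₁ := le_sup_left
    have l₂ : S₁ ≤ S₂ := le_sup_left
    have l₃ : S₂ ≤ S₃ := le_sup_left
    have hx : ∀ i, (Laurent.x i : OL R) ∈ S₃ := by
      intro i
      fin_cases i
      · exact l₃ (l₂ ((le_sup_right : _ ≤ S₁) (Algebra.self_mem_adjoin_singleton R _)))
      · exact l₃ ((le_sup_right : _ ≤ S₂) (Algebra.self_mem_adjoin_singleton R _))
      · exact (le_sup_right : _ ≤ S₃) (Algebra.self_mem_adjoin_singleton R _)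
    have htop : S₃ = ⊤ := by
      refine Laurent.eq_top_of_mem S₃ hx fun i => ?_
      -- For instance $\alpha^{-1} = a^{-1}\alpha$, so adjoining $\alpha$ also adjoins its inverse.
      have e : (Laurent.xinv i : OL R) = kummer R (Laurent.xinv i) * Laurent.x i := by
        have e1 := congrArg (kummer R) (Laurent.x_mul_xinv i)
        rw [map_mul, map_one, kummer, Laurent.lift_x, ← kummer] at e1
        have e2 := Laurent.x_mul_xinv (R := R) i
        linear_combination (-Laurent.xinv i : OL R) * e1 +
          (kummer R (Laurent.xinv i) * Laurent.x i) * e2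
      rw [e]
      exact mul_mem (l₃ (l₂ (l₁ ⟨_, rfl⟩))) (hx i)
    have m₃ : b ∈ S₃ := htop ▸ Algebra.mem_top
    -- The roots are removed in the reverse of the order in which they were adjoined.
    have m₂ : b ∈ S₂ := mem_of_map_eq_self S₂ (l₂ (l₁ (hsq 2))) _
      (sup_le (sup_le (h0 _) (hfix 2 0 (by decide))) (hfix 2 1 (by decide))) (hneg 2) m₃ (hb _)
    have m₁ : b ∈ S₁ := mem_of_map_eq_self S₁ (l₁ (hsq 1)) _
      (sup_le (h0 _) (hfix 1 0 (by decide))) (hneg 1) m₂ (hb _)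
    exact mem_of_map_eq_self _ (hsq 0) _ (h0 _) (hneg 0) m₁ (hb _)

end Kummer

/-! ### The torsor `𝔾_m⁴ × 𝓛 → 𝓧` -/

section MainTorsor

variable (R : Type u) [CommRing R]

/-- The functions `a` (index `0`) and `c` (index `1`) on `𝓧`. -/
noncomputable def acX (i : Fin 2) : OX R := fromRes R (fromS R (Laurent.x i))

/-- The functions `b` (index `0`) and `x` (index `1`) on `𝓧`. -/
noncomputable def bxX (i : Fin 2) : OX R := fromBX R (Laurent.x i)

/-- The functions `y₁, y_α, y_γ, y_{αγ}` on `𝓧`. -/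
noncomputable def yX (k : Fin 4) : OX R := fromRes R (yRes R k)

/-- The norm of `y` on `𝓧`. -/
noncomputable def normX : OX R := normPoly (acX R 0) (acX R 1) (yX R 0) (yX R 1) (yX R 2) (yX R 3)

lemma isUnit_acX (i : Fin 2) : IsUnit (acX R i) := ((Laurent.isUnit_x i).map _).map _

lemma isUnit_bxX (i : Fin 2) : IsUnit (bxX R i) := (Laurent.isUnit_x i).map _

lemma fromS_apply (z : OS R) :
    fromS R z = algebraMap (MvPolynomial (Fin 4) (OS R)) (ORes R) (.C z) :=
  rfl

lemma fromRes_resNorm : fromRes R (algebraMap _ (ORes R) (resNorm R)) = normX R := by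
  simp only [resNorm, normPoly, normX, map_sub, map_mul, map_pow, map_add, map_ofNat, ← fromS_apply]
  rfl

lemma bxX_mul_sq : bxX R 0 * bxX R 1 ^ 2 = normX R := by
  rw [← fromRes_resNorm]
  have h : mkX R (eqn R) = 0 := Ideal.Quotient.eq_zero_iff_mem.mpr (Ideal.mem_span_singleton_self _)
  rw [eqn, map_sub, sub_eq_zero] at h
  rw [bxX, bxX, ← map_pow, ← map_mul]
  exact h

lemma isUnit_normX : IsUnit (normX R) := by
  rw [← fromRes_resNorm]
  exact (IsLocalization.Away.algebraMap_isUnit (resNorm R)).map _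

/-- A homomorphism on the functions on `𝓧` is determined by the images of the coordinates. -/
lemma OX_hom_ext {T : Type u} [CommRing T] [Algebra R T] {φ ψ : OX R →ₐ[R] T}
    (h₁ : ∀ i, φ (acX R i) = ψ (acX R i)) (h₂ : ∀ i, φ (bxX R i) = ψ (bxX R i))
    (h₃ : ∀ k, φ (yX R k) = ψ (yX R k)) : φ = ψ := by
  apply Ideal.Quotient.algHom_ext
  apply Algebra.TensorProduct.ext
  · apply IsLocalization.algHom_ext (Submonoid.powers (resNorm R))
    have hC : (φ.comp (fromRes R)).comp (fromS R) = (ψ.comp (fromRes R)).comp (fromS R) :=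
      Laurent.hom_ext h₁
    apply AlgHom.ext
    intro z
    change φ (fromRes R (algebraMap _ (ORes R) z)) = ψ (fromRes R (algebraMap _ (ORes R) z))
    induction z using MvPolynomial.induction_on with
    | C z => exact DFunLike.congr_fun hC z
    | add p r hp hr => simp only [map_add, hp, hr]
    | mul_X p i hp =>
      simp only [map_mul, hp]
      exact congrArg _ (h₃ i)
  · exact Laurent.hom_ext h₂

variable [Invertible (2 : R)]

lemma torsorHom_fromRes (z : ORes R) : torsorHom R (fromRes R z) = resToP R z := by
  change torsorHom R (mkX R (z ⊗ₜ 1)) = _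
  rw [torsorHom_mk, Algebra.TensorProduct.lift_tmul, map_one, mul_one]

lemma resToP_algebraMap (z : MvPolynomial (Fin 4) (OS R)) :
    resToP R (algebraMap _ (ORes R) z) = polyToP R z :=
  IsLocalization.lift_eq _ z

lemma torsorHom_acX (i : Fin 2) : torsorHom R (acX R i) = ![lP R 0 ^ 2, lP R 2 ^ 2] i := by
  rw [acX, torsorHom_fromRes, fromS_apply, resToP_algebraMap, polyToP, MvPolynomial.aevalTower_C, Laurent.lift_x]

lemma torsorHom_bxX (i : Fin 2) : torsorHom R (bxX R i) = ![lP R 1 ^ 2, xP R] i := by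
  change torsorHom R (mkX R (1 ⊗ₜ Laurent.x i)) = _
  rw [torsorHom_mk, Algebra.TensorProduct.lift_tmul, map_one, one_mul, bxToP, Laurent.lift_x]

lemma torsorHom_yX (k : Fin 4) : torsorHom R (yX R k) =
    ![d1 R, d2 R * lPinv R 0, d3 R * lPinv R 2, d4 R * (lPinv R 0 * lPinv R 2)] k := by
  rw [yX, torsorHom_fromRes, yRes, resToP_algebraMap, polyToP, MvPolynomial.aevalTower_X]

/-- Square roots of `a`, `b`, `c` and of a quarter of three of the factors of the norm define a
factorization through `𝔾_m⁴ × 𝓛`. -/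
lemma exists_comp_torsorHom_eq {T : Type u} [CommRing T] [Algebra R T] (φ : OX R →ₐ[R] T)
    {α β γ u₁ u₂ u₃ : T} (hα : α ^ 2 = φ (acX R 0)) (hβ : β ^ 2 = φ (bxX R 0))
    (hγ : γ ^ 2 = φ (acX R 1))
    (h₁ : 4 * u₁ ^ 2 = φ (yX R 0) + φ (yX R 1) * α + φ (yX R 2) * γ + φ (yX R 3) * (α * γ))
    (h₂ : 4 * u₂ ^ 2 = φ (yX R 0) + φ (yX R 1) * α - φ (yX R 2) * γ - φ (yX R 3) * (α * γ))
    (h₃ : 4 * u₃ ^ 2 = φ (yX R 0) - φ (yX R 1) * α + φ (yX R 2) * γ - φ (yX R 3) * (α * γ)) :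
    ∃ ψ : OP R →ₐ[R] T, ψ.comp (torsorHom R) = φ := by
  obtain ⟨v, hv⟩ : ∃ v, v =
    φ (yX R 0) - φ (yX R 1) * α - φ (yX R 2) * γ + φ (yX R 3) * (α * γ) := ⟨_, rfl⟩
  -- $v$ is the fourth linear factor of the norm; the other three are $4u_1^2, 4u_2^2, 4u_3^2$. As
  -- the norm is a unit, so are $v$ and $u_1, u_2, u_3$.
  have hN : φ (normX R) = 64 * (u₁ * u₂ * u₃) ^ 2 * v := by
    have : φ (normX R) = (4 * u₁ ^ 2) * (4 * u₂ ^ 2) * (4 * u₃ ^ 2) * v := by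
      rw [h₁, h₂, h₃, hv]
      simp only [normX, normPoly, map_sub, map_mul, map_pow, map_add, map_ofNat, ← hα, ← hγ]
      ring
    rw [this]; ring
  have hNu : IsUnit (64 * (u₁ * u₂ * u₃) ^ 2 * v) := hN ▸ (isUnit_normX R).map φ
  have huuu : IsUnit (u₁ * u₂ * u₃) := by
    have := isUnit_of_mul_isUnit_right (isUnit_of_mul_isUnit_left hNu)
    rwa [isUnit_pow_iff two_ne_zero] at this
  have hu₁ : IsUnit u₁ := isUnit_of_mul_isUnit_left (isUnit_of_mul_isUnit_left huuu)
  have hu₂ : IsUnit u₂ := isUnit_of_mul_isUnit_right (isUnit_of_mul_isUnit_left huuu)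
  have hu₃ : IsUnit u₃ := isUnit_of_mul_isUnit_right huuu
  have hαu : IsUnit α := by
    rw [← isUnit_pow_iff two_ne_zero, hα]; exact (isUnit_acX R 0).map φ
  have hβu : IsUnit β := by
    rw [← isUnit_pow_iff two_ne_zero, hβ]; exact (isUnit_bxX R 0).map φ
  have hγu : IsUnit γ := by
    rw [← isUnit_pow_iff two_ne_zero, hγ]; exact (isUnit_acX R 1).map φ
  have h16 : IsUnit (2 ^ 4 * (u₁ * u₂ * u₃)) :=
    (isUnit_two_pow (R := R) 4).mul huuu
  obtain ⟨w, hw⟩ := h16.exists_right_inv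
  -- The value of $u_4$ is forced by $x = 2^4 u_1u_2u_3u_4/\beta$; no further square root has to be
  -- chosen.
  obtain ⟨u₄, hu₄⟩ : ∃ u₄, u₄ = φ (bxX R 1) * β * w := ⟨_, rfl⟩
  have hx : 2 ^ 4 * (u₁ * u₂ * u₃ * u₄) = φ (bxX R 1) * β := by
    rw [hu₄]
    linear_combination φ (bxX R 1) * β * hw
  -- This is where $b x^2 = N(y)$ enters: $(2^4u_1u_2u_3)^2 \cdot 4u_4^2 = 4 b x^2 = 4N =
  -- (2^4u_1u_2u_3)^2\, v$.
  have h₄ : 4 * u₄ ^ 2 = v := by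
    refine (h16.pow 2).mul_left_cancel ?_
    have e := congrArg φ (bxX_mul_sq R)
    rw [map_mul, map_pow, hN, ← hβ] at e
    linear_combination 4 * (2 ^ 4 * (u₁ * u₂ * u₃ * u₄) + φ (bxX R 1) * β) * hx + 4 * e
  have hu₄u : IsUnit u₄ := by
    have := isUnit_of_mul_isUnit_right hNu
    rw [← h₄] at this
    rw [← isUnit_pow_iff two_ne_zero]
    exact isUnit_of_mul_isUnit_right this
  let w' : ZMod 2 × ZMod 2 → T := fun k =>
    if k.1 = 0 then (if k.2 = 0 then u₁ else u₂) else (if k.2 = 0 then u₃ else u₄)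
  have hw' : ∀ k, IsUnit (w' k) := fun k => by
    dsimp only [w']
    split_ifs <;> assumption
  let l' : Fin 3 → T := ![α, β, γ]
  have hl' : ∀ i, IsUnit (l' i) := fun i => by fin_cases i <;> assumption
  let ψ : OP R →ₐ[R] T := Algebra.TensorProduct.lift (Laurent.lift w' hw') (Laurent.lift l' hl')
    fun _ _ => Commute.all _ _
  have hψu : ∀ k, ψ (uP R k) = w' k := fun k => by
    simp only [ψ, uP, Algebra.TensorProduct.lift_tmul, map_one, mul_one, Laurent.lift_x]
  have hψl : ∀ i, ψ (lP R i) = l' i := fun i => by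
    simp only [ψ, lP, Algebra.TensorProduct.lift_tmul, map_one, one_mul, Laurent.lift_x]
  have hψi : ∀ i, l' i * ψ (lPinv R i) = 1 := fun i => by
    rw [← hψl, ← map_mul, lP_mul_lPinv, map_one]
  have i0 : α * ψ (lPinv R 0) = 1 := hψi 0
  have i1 : β * ψ (lPinv R 1) = 1 := hψi 1
  have i2 : γ * ψ (lPinv R 2) = 1 := hψi 2
  have w1 : w' (0, 0) = u₁ := rfl
  have w2 : w' (0, 1) = u₂ := rfl
  have w3 : w' (1, 0) = u₃ := rfl
  have w4 : w' (1, 1) = u₄ := rfl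
  have h4u : IsUnit (4 : T) := by
    have := isUnit_two_pow (R := R) (B := T) 2
    norm_num at this
    exact this
  rw [hv] at h₄
  refine ⟨ψ, OX_hom_ext R (fun i => ?_) (fun i => ?_) fun k => ?_⟩
  · rw [AlgHom.comp_apply, torsorHom_acX]
    fin_cases i
    · change ψ (lP R 0 ^ 2) = φ (acX R 0)
      rw [map_pow, hψl, ← hα]; rfl
    · change ψ (lP R 2 ^ 2) = φ (acX R 1)
      rw [map_pow, hψl, ← hγ]; rfl
  · rw [AlgHom.comp_apply, torsorHom_bxX]
    fin_cases i
    · change ψ (lP R 1 ^ 2) = φ (bxX R 0)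
      rw [map_pow, hψl, ← hβ]; rfl
    · change ψ (xP R) = φ (bxX R 1)
      rw [xP]
      simp only [map_mul, map_pow, map_ofNat, hψu, w1, w2, w3, w4]
      linear_combination ψ (lPinv R 1) * hx + φ (bxX R 1) * i1
  · rw [AlgHom.comp_apply, torsorHom_yX]
    -- After multiplication by $4$, the signed sums of the four equations for $4u_k^2$ isolate one
    -- coordinate of $y$ each, by orthogonality of the characters of $(\mathbb Z/2)^2$.
    refine h4u.mul_left_cancel ?_
    fin_cases k
    · change 4 * ψ (d1 R) = 4 * φ (yX R 0)
      simp only [d1, map_add, map_pow, hψu, w1, w2, w3, w4]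
      linear_combination h₁ + h₂ + h₃ + h₄
    · change 4 * ψ (d2 R * lPinv R 0) = 4 * φ (yX R 1)
      simp only [d2, map_mul, map_add, map_sub, map_pow, hψu, w1, w2, w3, w4]
      linear_combination ψ (lPinv R 0) * (h₁ + h₂ - h₃ - h₄) + 4 * φ (yX R 1) * i0
    · change 4 * ψ (d3 R * lPinv R 2) = 4 * φ (yX R 2)
      simp only [d3, map_mul, map_add, map_sub, map_pow, hψu, w1, w2, w3, w4]
      linear_combination ψ (lPinv R 2) * (h₁ - h₂ + h₃ - h₄) + 4 * φ (yX R 2) * i2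
    · change 4 * ψ (d4 R * (lPinv R 0 * lPinv R 2)) = 4 * φ (yX R 3)
      simp only [d4, map_mul, map_add, map_sub, map_pow, hψu, w1, w2, w3, w4]
      linear_combination ψ (lPinv R 0) * ψ (lPinv R 2) * (h₁ - h₂ - h₃ + h₄) +
        4 * φ (yX R 3) * (γ * ψ (lPinv R 2)) * i0 + 4 * φ (yX R 3) * i2

/-- Six successive extensions adjoin roots of $a, b, c$ and of a quarter of three factors of the
norm. Each is injective, and their composite factors through `torsorHom`. -/
lemma torsorHom_injective : Function.Injective (torsorHom R) := by
  obtain ⟨T₁, _, _, φ₁, α, j₁, hα⟩ := exists_injective_sq_eq (R := R) (acX R 0)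
  obtain ⟨T₂, _, _, φ₂, β, j₂, hβ⟩ := exists_injective_sq_eq (R := R) (φ₁ (bxX R 0))
  obtain ⟨T₃, _, _, φ₃, γ, j₃, hγ⟩ := exists_injective_sq_eq (R := R) (φ₂ (φ₁ (acX R 1)))
  have quarter : ∀ {T : Type u} [CommRing T] [Algebra R T] (v t : T),
      t ^ 2 = ((⅟2 : R) ^ 2) • v → 4 * t ^ 2 = v := fun {T} _ _ v t h => by
    have e : (4 : T) = algebraMap R T ((2 : R) ^ 2) := by rw [map_pow, map_ofNat]; norm_num
    rw [h, e, ← Algebra.smul_def, smul_smul, ← mul_pow, mul_invOf_self, one_pow, one_smul]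
  let χ : OX R →ₐ[R] T₃ := (φ₃.comp φ₂).comp φ₁
  let α' : T₃ := φ₃ (φ₂ α)
  obtain ⟨T₄, _, _, φ₄, u₁, j₄, h₁⟩ := exists_injective_sq_eq (R := R) (((⅟2 : R) ^ 2) •
    (χ (yX R 0) + χ (yX R 1) * α' + χ (yX R 2) * γ + χ (yX R 3) * (α' * γ)))
  obtain ⟨T₅, _, _, φ₅, u₂, j₅, h₂⟩ := exists_injective_sq_eq (R := R) (φ₄ (((⅟2 : R) ^ 2) •
    (χ (yX R 0) + χ (yX R 1) * α' - χ (yX R 2) * γ - χ (yX R 3) * (α' * γ))))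
  obtain ⟨T₆, _, _, φ₆, u₃, j₆, h₃⟩ := exists_injective_sq_eq (R := R)
    (φ₅ (φ₄ (((⅟2 : R) ^ 2) •
      (χ (yX R 0) - χ (yX R 1) * α' + χ (yX R 2) * γ - χ (yX R 3) * (α' * γ)))))
  let φ : OX R →ₐ[R] T₆ := ((φ₆.comp φ₅).comp φ₄).comp χ
  obtain ⟨ψ, hψ⟩ := exists_comp_torsorHom_eq R φ (α := φ₆ (φ₅ (φ₄ α')))
    (β := φ₆ (φ₅ (φ₄ (φ₃ β)))) (γ := φ₆ (φ₅ (φ₄ γ))) (u₁ := φ₆ (φ₅ u₁)) (u₂ := φ₆ u₂) (u₃ := u₃)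
    (by simp only [α', ← map_pow, hα]; rfl)
    (by simp only [← map_pow, hβ]; rfl)
    (by simp only [← map_pow, hγ]; rfl)
    (quarter _ _ (by simp only [← map_pow, h₁, map_smul, map_add, map_mul]; rfl))
    (quarter _ _ (by simp only [← map_pow, h₂, map_smul, map_add, map_sub, map_mul]; rfl))
    (quarter _ _ (by simp only [h₃, map_smul, map_add, map_sub, map_mul]; rfl))
  have hφ : Function.Injective φ := j₆.comp (j₅.comp (j₄.comp (j₃.comp (j₂.comp j₁))))
  rw [← hψ, AlgHom.coe_comp] at hφ
  exact hφ.of_comp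

end MainTorsor

/-! ### Separation and invariants for the action of $U_4$ on $\mathbb G_m^4 \times \mathcal L$ -/

section MainTorsor

/-- These are the elements of $\ker q$. They map each $u_k$ to a multiple of itself, and the signs
at $(0,0), (0,1), (1,0)$ determine the three remaining entries, so the action of $\ker q$ is
faithful. -/
lemma eps_of_entry_eq_zero (h : U4) (h01 : entry 0 1 h = 0) (h12 : entry 1 2 h = 0) (h23 : entry 2 3 h = 0)
    (k : ZMod 2 × ZMod 2) :
    eps h k = entry 0 3 h + k.1 * entry 1 3 h + k.2 * entry 0 2 h := by
  obtain ⟨b1, b2, b3, b4, b5, b6⟩ := base_entries k.1 0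
  simp only [eps, sg, posn, a01_mul, a02_mul, a03_mul, a12_mul, a13_mul, a23_mul, b1, b2, b3, b4,
    b5, b6, h01, h12, h23]
  ring

lemma eq_one_of_entry_eq_zero (h : U4) (h01 : entry 0 1 h = 0) (h12 : entry 1 2 h = 0)
    (h23 : entry 2 3 h = 0) (h02 : entry 0 2 h = 0) (h13 : entry 1 3 h = 0)
    (h03 : entry 0 3 h = 0) : h = 1 := by
  apply Subtype.ext
  apply Units.ext
  ext i j
  change entry i j h = (1 : Matrix (Fin 4) (Fin 4) (ZMod 2)) i j
  rcases lt_trichotomy i j with hij | rfl | hij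
  · rw [Matrix.one_apply_ne hij.ne]
    fin_cases i <;> fin_cases j <;> first | exact absurd hij (by decide) | assumption
  · rw [a_diag, Matrix.one_apply_eq]
  · rw [a_low i j hij, Matrix.one_apply_ne hij.ne']

variable (R : Type u) [CommRing R]

lemma OP_eq_top_of_mem (S : Subalgebra R (OP R)) (hu : ∀ k, uP R k ∈ S) (hl : ∀ i, lP R i ∈ S)
    (hu' : ∀ k, ∃ s ∈ S, uP R k * s = 1) (hl' : ∀ i, lPinv R i ∈ S) : S = ⊤ := by
  have h1 : S.comap (Algebra.TensorProduct.includeLeft : OG R →ₐ[R] OP R) = ⊤ := by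
    refine Laurent.eq_top_of_mem _ hu fun k => ?_
    obtain ⟨s, hs, h⟩ := hu' k
    change (Laurent.xinv k ⊗ₜ 1 : OP R) ∈ S
    have e : uP R k * (Laurent.xinv k ⊗ₜ 1) = 1 := by
      rw [uP, Algebra.TensorProduct.tmul_mul_tmul, Laurent.x_mul_xinv, one_mul]; rfl
    rwa [(isUnit_uP R k).mul_left_cancel (e.trans h.symm)]
  have h2 : S.comap (Algebra.TensorProduct.includeRight : OL R →ₐ[R] OP R) = ⊤ :=
    Laurent.eq_top_of_mem _ hl hl'
  rw [eq_top_iff]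
  rintro z -
  induction z using TensorProduct.induction_on with
  | zero => exact zero_mem _
  | add y z hy hz => exact add_mem hy hz
  | tmul y z =>
    have hy : (y ⊗ₜ 1 : OP R) ∈ S := (SetLike.ext_iff.mp h1 y).mpr Algebra.mem_top
    have hz : (1 ⊗ₜ z : OP R) ∈ S := (SetLike.ext_iff.mp h2 z).mpr Algebra.mem_top
    have e : (y ⊗ₜ z : OP R) = y ⊗ₜ 1 * 1 ⊗ₜ z := by
      rw [Algebra.TensorProduct.tmul_mul_tmul, mul_one, one_mul]
    rw [e]
    exact mul_mem hy hz

variable [Invertible (2 : R)]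

lemma actP_uP_of_q_eq_one (g : U4) (hg : q g = 1) (k : ZMod 2 × ZMod 2) :
    actP R g (uP R k) = sgn R (eps g⁻¹ k) • uP R k := by
  have h01 : entry 0 1 g = 0 := congrFun (congrArg Multiplicative.toAdd hg) 0
  have h23 : entry 2 3 g = 0 := congrFun (congrArg Multiplicative.toAdd hg) 2
  have hs : shift g⁻¹ k = k := by simp [shift, inv_a01, inv_a23, h01, h23]
  rw [actP_uP, hs]

/-- Outside $\ker q$, $g$ negates one of $\alpha, \beta, \gamma$; a nontrivial element of $\ker q$
negates some $u_k^*$. In both cases the difference is $-2$ times a unit. -/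
lemma torsorHom_separated (g : U4) (hg : g ≠ 1) : ∃ b, IsUnit (actP R g b - b) := by
  by_cases hq : ∃ i, Multiplicative.toAdd (q g) i ≠ 0
  · obtain ⟨i, hi⟩ := hq
    refine ⟨lP R i, ?_⟩
    rw [actP_lP, zmod_two_eq_one hi, sgn_one, neg_one_smul]
    exact isUnit_neg_sub_self (R := R) (isUnit_lP R i)
  · push Not at hq
    have hq1 : q g = 1 := Multiplicative.toAdd.injective (funext hq)
    obtain ⟨k, hk⟩ : ∃ k, eps g⁻¹ k ≠ 0 := by
      by_contra! h0
      have h01 : entry 0 1 g⁻¹ = 0 := (inv_a01 g).trans (hq 0)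
      have h12 : entry 1 2 g⁻¹ = 0 := (inv_a12 g).trans (hq 1)
      have h23 : entry 2 3 g⁻¹ = 0 := (inv_a23 g).trans (hq 2)
      simp only [eps_of_entry_eq_zero g⁻¹ h01 h12 h23] at h0
      have e00 := h0 (0, 0)
      have e01 := h0 (0, 1)
      have e10 := h0 (1, 0)
      simp only [zero_mul, one_mul, add_zero] at e00 e01 e10
      rw [e00, zero_add] at e01 e10
      exact hg (inv_eq_one.mp (eq_one_of_entry_eq_zero _ h01 h12 h23 e01 e10 e00))
    refine ⟨uP R k, ?_⟩
    rw [actP_uP_of_q_eq_one R g hq1, zmod_two_eq_one hk, sgn_one, neg_one_smul]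
    exact isUnit_neg_sub_self (R := R) (isUnit_uP R k)

/-- Four times the square of `u_k^*` is a factor of the norm. -/
lemma four_mul_uP_sq (k : ZMod 2 × ZMod 2) : 2 ^ 2 * uP R k ^ 2 =
    torsorHom R (yX R 0) + sgn R k.1 • (torsorHom R (yX R 1) * lP R 0) +
      sgn R k.2 • (torsorHom R (yX R 2) * lP R 2) +
      sgn R (k.1 + k.2) • (torsorHom R (yX R 3) * (lP R 0 * lP R 2)) := by
  have e0 := lP_mul_lPinv R 0
  have e2 := lP_mul_lPinv R 2
  have y0 : torsorHom R (yX R 0) = d1 R := torsorHom_yX R 0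
  have y1 : torsorHom R (yX R 1) * lP R 0 = d2 R := by
    rw [show torsorHom R (yX R 1) = d2 R * lPinv R 0 from torsorHom_yX R 1]
    linear_combination d2 R * e0
  have y2 : torsorHom R (yX R 2) * lP R 2 = d3 R := by
    rw [show torsorHom R (yX R 2) = d3 R * lPinv R 2 from torsorHom_yX R 2]
    linear_combination d3 R * e2
  have y3 : torsorHom R (yX R 3) * (lP R 0 * lP R 2) = d4 R := by
    rw [show torsorHom R (yX R 3) = d4 R * (lPinv R 0 * lPinv R 2) from torsorHom_yX R 3]
    linear_combination d4 R * (lP R 2 * lPinv R 2) * e0 + d4 R * e2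
  rw [y0, y1, y2, y3, d1, d2, d3, d4]
  have e : (1 : ZMod 2) + 1 = 0 := rfl
  obtain ⟨i, j⟩ := k
  have hi : i = 0 ∨ i = 1 := by revert i; decide
  have hj : j = 0 ∨ j = 1 := by revert j; decide
  rcases hi with rfl | rfl <;> rcases hj with rfl | rfl <;>
    simp only [add_zero, zero_add, e, sgn_zero, sgn_one, one_smul, neg_one_smul] <;> ring

/-- The invariants are found along the tower that adjoins $\alpha, \beta, \gamma, u_1^*, u_2^*,
u_3^*$ to the image of the functions on $\mathcal X$. -/
lemma torsorHom_isGaloisHom : IsGaloisHom (torsorHom R) (actP R) where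
  invariant := torsorHom_invariant R
  injective := torsorHom_injective R
  separated := torsorHom_separated R
  fixed b hb := by
    set S₀ := (torsorHom R).range
    have hr : ∀ z, torsorHom R z ∈ S₀ := fun z => ⟨z, rfl⟩
    have h0 : ∀ g, S₀ ≤ AlgHom.equalizer (actP R g) (AlgHom.id R (OP R)) := by
      rintro g _ ⟨z, rfl⟩
      exact torsorHom_invariant R g z
    have hsq : ∀ i, lP R i ^ 2 ∈ S₀ := by
      intro i
      fin_cases i
      · exact ⟨_, torsorHom_acX R 0⟩
      · exact ⟨_, torsorHom_bxX R 0⟩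
      · exact ⟨_, torsorHom_acX R 1⟩
    set S₁ := S₀ ⊔ Algebra.adjoin R {lP R 0}
    set S₂ := S₁ ⊔ Algebra.adjoin R {lP R 1}
    set S₃ := S₂ ⊔ Algebra.adjoin R {lP R 2}
    set S₄ := S₃ ⊔ Algebra.adjoin R {uP R (0, 0)}
    set S₅ := S₄ ⊔ Algebra.adjoin R {uP R (0, 1)}
    set S₆ := S₅ ⊔ Algebra.adjoin R {uP R (1, 0)}
    have l₁ : S₀ ≤ S₁ := le_sup_left
    have l₂ : S₁ ≤ S₂ := le_sup_left
    have l₃ : S₂ ≤ S₃ := le_sup_left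
    have l₄ : S₃ ≤ S₄ := le_sup_left
    have l₅ : S₄ ≤ S₅ := le_sup_left
    have l₆ : S₅ ≤ S₆ := le_sup_left
    have l03 : S₀ ≤ S₃ := l₁.trans (l₂.trans l₃)
    have l36 : S₃ ≤ S₆ := l₄.trans (l₅.trans l₆)
    have hself : ∀ t : OP R, t ∈ Algebra.adjoin R {t} := Algebra.self_mem_adjoin_singleton R
    have hl : ∀ i, lP R i ∈ S₃ := by
      intro i
      fin_cases i
      · exact l₃ (l₂ ((le_sup_right : _ ≤ S₁) (hself _)))
      · exact l₃ ((le_sup_right : _ ≤ S₂) (hself _))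
      · exact (le_sup_right : _ ≤ S₃) (hself _)
    -- Once $\alpha$ and $\gamma$ are available, the norm splits into its linear factors
    -- $4u_k^{*2}$.
    have husq : ∀ k, uP R k ^ 2 ∈ S₃ := fun k => by
      refine mem_of_two_pow_mul_mem S₃ 2 ?_
      rw [four_mul_uP_sq]
      exact add_mem (add_mem (add_mem (l03 (hr _))
        (S₃.smul_mem (mul_mem (l03 (hr _)) (hl 0)) _))
        (S₃.smul_mem (mul_mem (l03 (hr _)) (hl 2)) _))
        (S₃.smul_mem (mul_mem (l03 (hr _)) (mul_mem (hl 0) (hl 2))) _)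
    have hlinv : ∀ i, lPinv R i ∈ S₃ := by
      have key : ∀ i (z : OX R), IsUnit z → torsorHom R z = lP R i ^ 2 → lPinv R i ∈ S₃ := by
        intro i z hz e
        obtain ⟨z', hz'⟩ := hz.exists_right_inv
        have e1 := congrArg (torsorHom R) hz'
        rw [map_mul, e, map_one] at e1
        have e2 : lPinv R i = torsorHom R z' * lP R i := by
          linear_combination (-lPinv R i) * e1 +
            (torsorHom R z' * lP R i) * lP_mul_lPinv R i
        rw [e2]
        exact mul_mem (l03 (hr _)) (hl i)
      intro i
      fin_cases i
      · exact key _ _ (isUnit_acX R 0) (torsorHom_acX R 0)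
      · exact key _ _ (isUnit_bxX R 0) (torsorHom_bxX R 0)
      · exact key _ _ (isUnit_acX R 1) (torsorHom_acX R 1)
    have hxP : torsorHom R (bxX R 1) = xP R := torsorHom_bxX R 1
    -- The norm is a unit on $\mathcal X$, so this product formula provides inverses of the
    -- $u_k^{*2}$ within `S₃`.
    have hprod : torsorHom R (normX R) =
        2 ^ 8 * (uP R (0, 0) ^ 2 * uP R (0, 1) ^ 2 * uP R (1, 0) ^ 2 * uP R (1, 1) ^ 2) := by
      rw [← bxX_mul_sq, map_mul, map_pow, hxP,
        show torsorHom R (bxX R 0) = lP R 1 ^ 2 from torsorHom_bxX R 0, xP]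
      linear_combination (2 ^ 8 * (uP R (0, 0) ^ 2 * uP R (0, 1) ^ 2 * uP R (1, 0) ^ 2 *
        uP R (1, 1) ^ 2) * (lP R 1 * lPinv R 1 + 1)) * lP_mul_lPinv R 1
    obtain ⟨n', hn'⟩ := (isUnit_normX R).exists_right_inv
    have hn : 2 ^ 8 * (uP R (0, 0) ^ 2 * uP R (0, 1) ^ 2 * uP R (1, 0) ^ 2 * uP R (1, 1) ^ 2) *
        torsorHom R n' = 1 := by rw [← hprod, ← map_mul, hn', map_one]
    have h2 : ∀ n : ℕ, (2 ^ n : OP R) ∈ S₃ := fun n => pow_mem (ofNat_mem S₃ 2) n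
    have hsqinv : ∀ k, ∃ s ∈ S₃, uP R k ^ 2 * s = 1 := by
      have key : ∀ k l m n, uP R k ^ 2 * (2 ^ 8 * (uP R l ^ 2 * uP R m ^ 2 * uP R n ^ 2) *
          torsorHom R n') = 1 → ∃ s ∈ S₃, uP R k ^ 2 * s = 1 := fun k l m n e =>
        ⟨_, mul_mem (mul_mem (h2 8) (mul_mem (mul_mem (husq l) (husq m)) (husq n))) (l03 (hr _)), e⟩
      rintro ⟨i, j⟩
      have hi : i = 0 ∨ i = 1 := by revert i; decide
      have hj : j = 0 ∨ j = 1 := by revert j; decide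
      rcases hi with rfl | rfl <;> rcases hj with rfl | rfl
      · exact key _ (0, 1) (1, 0) (1, 1) (by linear_combination hn)
      · exact key _ (0, 0) (1, 0) (1, 1) (by linear_combination hn)
      · exact key _ (0, 0) (0, 1) (1, 1) (by linear_combination hn)
      · exact key _ (0, 0) (0, 1) (1, 0) (by linear_combination hn)
    have hinv : ∀ k, uP R k ∈ S₆ → ∃ s ∈ S₆, uP R k * s = 1 := fun k hk => by
      obtain ⟨s, hs, e⟩ := hsqinv k
      exact ⟨uP R k * s, mul_mem hk (l36 hs), by rw [← e]; ring⟩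
    have m00 : uP R (0, 0) ∈ S₆ := l₆ (l₅ ((le_sup_right : _ ≤ S₄) (hself _)))
    have m01 : uP R (0, 1) ∈ S₆ := l₆ ((le_sup_right : _ ≤ S₅) (hself _))
    have m10 : uP R (1, 0) ∈ S₆ := (le_sup_right : _ ≤ S₆) (hself _)
    -- $u_4^*$ is recovered from $x\beta = 2^4u_1^*u_2^*u_3^*u_4^*$, since the other three factors
    -- are invertible in `S₆`.
    have m11 : uP R (1, 1) ∈ S₆ := by
      obtain ⟨s₁, hs₁, e₁⟩ := hinv _ m00
      obtain ⟨s₂, hs₂, e₂⟩ := hinv _ m01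
      obtain ⟨s₃, hs₃, e₃⟩ := hinv _ m10
      refine mem_of_two_pow_mul_mem S₆ 4 ?_
      have e : 2 ^ 4 * uP R (1, 1) = torsorHom R (bxX R 1) * lP R 1 * (s₁ * s₂ * s₃) := by
        rw [hxP, xP]
        have e4 : uP R (0, 0) * uP R (0, 1) * uP R (1, 0) * (s₁ * s₂ * s₃) = 1 := by
          calc _ = (uP R (0, 0) * s₁) * (uP R (0, 1) * s₂) * (uP R (1, 0) * s₃) := by ring
            _ = 1 := by rw [e₁, e₂, e₃]; ring
        linear_combination (-2 ^ 4 * uP R (1, 1)) * e4 - 2 ^ 4 * uP R (1, 1) *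
          (uP R (0, 0) * uP R (0, 1) * uP R (1, 0) * (s₁ * s₂ * s₃)) * lP_mul_lPinv R 1
      rw [e]
      exact mul_mem (mul_mem (l36 (l03 (hr _))) (l36 (hl 1))) (mul_mem (mul_mem hs₁ hs₂) hs₃)
    have hu : ∀ k, uP R k ∈ S₆ := by
      rintro ⟨i, j⟩
      have hi : i = 0 ∨ i = 1 := by revert i; decide
      have hj : j = 0 ∨ j = 1 := by revert j; decide
      rcases hi with rfl | rfl <;> rcases hj with rfl | rfl <;> assumption
    have htop : S₆ = ⊤ := OP_eq_top_of_mem R S₆ hu (fun i => l36 (hl i))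
      (fun k => hinv k (hu k)) (fun i => l36 (hlinv i))
    have fl : ∀ (g : U4) (i : Fin 3), Multiplicative.toAdd (q g) i = 0 →
        Algebra.adjoin R {lP R i} ≤ AlgHom.equalizer (actP R g) (AlgHom.id R (OP R)) :=
      fun g i h => adjoin_singleton_le_equalizer (by rw [actP_lP, h, sgn_zero, one_smul])
    have nl : ∀ (g : U4) (i : Fin 3), Multiplicative.toAdd (q g) i = 1 →
        actP R g (lP R i) = -lP R i :=
      fun g i h => by rw [actP_lP, h, sgn_one, neg_one_smul]
    have fu : ∀ (g : U4) k, q g = 1 → eps g⁻¹ k = 0 →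
        Algebra.adjoin R {uP R k} ≤ AlgHom.equalizer (actP R g) (AlgHom.id R (OP R)) :=
      fun g k hg h => adjoin_singleton_le_equalizer (by
        rw [actP_uP_of_q_eq_one R g hg, h, sgn_zero, one_smul])
    have nu : ∀ (g : U4) k, q g = 1 → eps g⁻¹ k = 1 → actP R g (uP R k) = -uP R k :=
      fun g k hg h => by rw [actP_uP_of_q_eq_one R g hg, h, sgn_one, neg_one_smul]
    have f₃ : ∀ g, q g = 1 → S₃ ≤ AlgHom.equalizer (actP R g) (AlgHom.id R (OP R)) :=
      fun g hg => sup_le (sup_le (sup_le (h0 g) (fl g 0 (by rw [hg]; rfl)))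
        (fl g 1 (by rw [hg]; rfl))) (fl g 2 (by rw [hg]; rfl))
    have m₆ : b ∈ S₆ := htop ▸ Algebra.mem_top
    -- In the usual numbering, $E_{24}, E_{13}, E_{14} \in \ker q$ fix $\alpha, \beta, \gamma$.
    -- $E_{24}$ negates $u_3^*$ and fixes $u_1^*, u_2^*$; $E_{13}$ negates $u_2^*$ and fixes
    -- $u_1^*$; $E_{14}$ negates $u_1^*$.
    have m₅ : b ∈ S₅ := mem_of_map_eq_self S₅ (l₅ (l₄ (husq _))) (actP R (E 1 3 (by decide)))
      (sup_le (sup_le (f₃ _ (by decide)) (fu _ _ (by decide) (by decide)))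
        (fu _ _ (by decide) (by decide))) (nu _ _ (by decide) (by decide)) m₆ (hb _)
    have m₄ : b ∈ S₄ := mem_of_map_eq_self S₄ (l₄ (husq _)) (actP R (E 0 2 (by decide)))
      (sup_le (f₃ _ (by decide)) (fu _ _ (by decide) (by decide)))
      (nu _ _ (by decide) (by decide)) m₅ (hb _)
    have m₃ : b ∈ S₃ := mem_of_map_eq_self S₃ (husq _) (actP R (E 0 3 (by decide)))
      (f₃ _ (by decide)) (nu _ _ (by decide) (by decide)) m₄ (hb _)
    -- Only $\alpha, \beta, \gamma$ are left, so it no longer matters that $E_{34}$ and $E_{12}$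
    -- permute the $u_k^*$.
    have m₂ : b ∈ S₂ := mem_of_map_eq_self S₂ (l₂ (l₁ (hsq 2))) (actP R (E 2 3 (by decide)))
      (sup_le (sup_le (h0 _) (fl _ _ (by decide))) (fl _ _ (by decide)))
      (nl _ _ (by decide)) m₃ (hb _)
    have m₁ : b ∈ S₁ := mem_of_map_eq_self S₁ (l₁ (hsq 1)) (actP R (E 1 2 (by decide)))
      (sup_le (h0 _) (fl _ _ (by decide))) (nl _ _ (by decide)) m₂ (hb _)
    exact mem_of_map_eq_self S₀ (hsq 0) (actP R (E 0 1 (by decide)))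
      (h0 _) (nl _ _ (by decide)) m₁ (hb _)

end MainTorsor

/-! ### The push-forward along `q` and the pull-back of the Kummer torsor -/

section PushForward

/-- Invariance under $H$ makes a family $H \to B$ constant, and membership in the push-forward ring
then makes its value $G$-invariant. This is $(q_*P)/H = P/G$, valid for every homomorphism $q$. -/
lemma isInvariantRing_pushStr {R : Type u} [CommRing R] {A B : Type u} [CommRing A] [CommRing B]
    [Algebra R A] [Algebra R B] {G H : Type} [Group G] [Group H] (q : G →* H)
    {f : A →ₐ[R] B} {ρ : G →* (B →ₐ[R] B)} (h : IsInvariantRing f ρ) :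
    IsInvariantRing (pushStr q ρ f h.invariant) (pushAction q ρ) where
  invariant _ _ := rfl
  injective _ _ e := h.injective (congrFun (congrArg Subtype.val e) 1)
  fixed φ hφ := by
    have hc : ∀ k, φ.1 k = φ.1 1 := fun k => by
      have e : φ.1 (k⁻¹ * k) = φ.1 k := congrFun (congrArg Subtype.val (hφ k)) k
      rw [← e, inv_mul_cancel]
    obtain ⟨a, ha⟩ := h.fixed (φ.1 1) fun g => by
      have e : ρ g (φ.1 (1 * q g)) = φ.1 1 := congrFun (φ.2 g) 1
      rwa [hc] at e
    exact ⟨a, Subtype.ext (funext fun k => ha.trans (hc k).symm)⟩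

variable (R : Type u) [CommRing R] [Invertible (2 : R)]

/-- The comorphism of the morphism `q_* (𝔾_m⁴ × 𝓛) → 𝓛` that belongs to the `U₄`-equivariant
projection `𝔾_m⁴ × 𝓛 → 𝓛`. -/
noncomputable def pushToL : OL R →ₐ[R] pushRing q (actP R) :=
  AlgHom.codRestrict (AlgHom.pi fun h : K =>
    (Algebra.TensorProduct.includeRight : OL R →ₐ[R] OP R).comp (actL R h⁻¹)) _ (fun c g => by
    funext h
    change Algebra.TensorProduct.map (actG R g) (actL R (q g)) (1 ⊗ₜ actL R (h * q g)⁻¹ c) =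
      1 ⊗ₜ actL R h⁻¹ c
    rw [Algebra.TensorProduct.map_tmul, map_one, ← AlgHom.mul_apply, ← map_mul, mul_inv_rev,
      mul_inv_cancel_left])

/-- On points the map is $[h, (v, l)] \mapsto h l$, which commutes with left translation by $k$. -/
lemma pushToL_actL (k : K) (c : OL R) :
    pushToL R (actL R k c) = pushAction q (actP R) k (pushToL R c) := by
  apply Subtype.ext
  funext h
  change (1 ⊗ₜ actL R h⁻¹ (actL R k c) : OP R) = 1 ⊗ₜ actL R (k⁻¹ * h)⁻¹ c
  rw [← AlgHom.mul_apply, ← map_mul, mul_inv_rev, inv_inv]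

/-- Both routes from $\mathbb G_m^4 \times \mathcal L$ to $L_a \times L_b \times L_c$ square
$\alpha, \beta, \gamma$. This puts $q_*P \to \mathcal L$ over $\pi$. -/
lemma torsorHom_piX (z : Oabc R) :
    torsorHom R (piX R z) = (1 ⊗ₜ kummer R z : OP R) := by
  suffices h : (torsorHom R).comp (piX R) =
      (Algebra.TensorProduct.includeRight : OL R →ₐ[R] OP R).comp (kummer R) from
    DFunLike.congr_fun h z
  apply Laurent.hom_ext
  intro i
  rw [AlgHom.comp_apply, AlgHom.comp_apply, piX, kummer, Laurent.lift_x, Laurent.lift_x, map_pow]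
  fin_cases i
  · exact torsorHom_acX R 0
  · exact torsorHom_bxX R 0
  · exact torsorHom_acX R 1

lemma pushToL_kummer (z : Oabc R) : pushToL R (kummer R z) =
    pushStr q (actP R) (torsorHom R) (torsorHom_invariant R) (piX R z) := by
  apply Subtype.ext
  funext h
  change (1 ⊗ₜ actL R h⁻¹ (kummer R z) : OP R) = torsorHom R (piX R z)
  rw [kummer_invariant, torsorHom_piX]

lemma isInvariantRing_push :
    IsInvariantRing (pushStr q (actP R) (torsorHom R) (torsorHom_invariant R))
      (pushAction q (actP R)) :=
  isInvariantRing_pushStr q (torsorHom_isGaloisHom R).toIsInvariantRing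

/-- The separating elements are images of those of the Kummer extension: an equivariant homomorphism
preserves the unit $kc - c$. -/
lemma push_isGaloisHom :
    IsGaloisHom (pushStr q (actP R) (torsorHom R) (torsorHom_invariant R))
      (pushAction q (actP R)) where
  toIsInvariantRing := isInvariantRing_push R
  separated k hk := by
    obtain ⟨c, hc⟩ := (kummer_isGaloisHom R).separated k hk
    refine ⟨pushToL R c, ?_⟩
    rw [← pushToL_actL, ← map_sub]
    exact hc.map _

/-- The pushout criterion applies to the Kummer extension and the equivariant map `pushToL`, so
$q_*P$ is itself a fibre product $\mathcal X \times_{L_a \times L_b \times L_c} \mathcal L$.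
Equivariance is checked on the two projections. -/
lemma torsorIso_push_pull :
    TorsorIso (pushMap R) (pushForwardAction R) (pullMap R) (pullBackAction R) := by
  have hp : IsPullback (pushMap R) (specMap (pushToL R)) (structureMap R) (kummerMap R) :=
    isPullback_SpecMap_of_isPushout _ _ _ _ ((kummer_isGaloisHom R).isPushout
      (isInvariantRing_push R) (piX R) (pushToL R) (pushToL_kummer R) (pushToL_actL R))
  have h₁ : ∀ k, (pullBackAction R).act k ≫ pullback.fst (structureMap R) (kummerMap R) =
      pullback.fst (structureMap R) (kummerMap R) := fun k => pullback.lift_fst _ _ _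
  have h₂ : ∀ k, (pullBackAction R).act k ≫ pullback.snd (structureMap R) (kummerMap R) =
      pullback.snd (structureMap R) (kummerMap R) ≫ (kummerAction R).act k :=
    fun k => pullback.lift_snd _ _ _
  refine ⟨hp.isoPullback, hp.isoPullback_hom_fst, fun k => ?_⟩
  apply pullback.hom_ext
  · rw [Category.assoc, Category.assoc, h₁, hp.isoPullback_hom_fst]
    exact (push_isGaloisHom R).isTorsor.invariant k
  · rw [Category.assoc, Category.assoc, h₂, hp.isoPullback_hom_snd,
      hp.isoPullback_hom_snd_assoc]
    change Spec.map _ ≫ Spec.map _ = Spec.map _ ≫ Spec.map _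
    rw [← Spec.map_comp, ← Spec.map_comp]
    congr 1
    refine CommRingCat.hom_ext (RingHom.ext fun c => ?_)
    exact (pushToL_actL R k⁻¹ c).symm

end PushForward

end MasseyTorsor

theorem mainTheorem4 (R : Type u) [CommRing R] [Invertible (2 : R)] :
    MasseyTorsor.IsTorsor (MasseyTorsor.torsorMap R) (MasseyTorsor.torsorAction R) ∧
    MasseyTorsor.IsTorsor (MasseyTorsor.kummerMap R) (MasseyTorsor.kummerAction R) ∧
    MasseyTorsor.IsTorsor (MasseyTorsor.pushMap R) (MasseyTorsor.pushForwardAction R) ∧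
    MasseyTorsor.IsTorsor (MasseyTorsor.pullMap R) (MasseyTorsor.pullBackAction R) ∧
    MasseyTorsor.TorsorIso
      (MasseyTorsor.pushMap R) (MasseyTorsor.pushForwardAction R)
      (MasseyTorsor.pullMap R) (MasseyTorsor.pullBackAction R) := by
  have h := (MasseyTorsor.push_isGaloisHom R).isTorsor
  have e := MasseyTorsor.torsorIso_push_pull R
  -- The torsor property of $\pi^*\mathcal L$ is transported from $q_*P$ along the isomorphism.
  exact ⟨(MasseyTorsor.torsorHom_isGaloisHom R).isTorsor,
    (MasseyTorsor.kummer_isGaloisHom R).isTorsor, h, h.of_torsorIso e, e⟩
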